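/- Beeping networks. Let $G=(V,E)$ be a finite simple graph with $n=|V|$ nodes and maximum degree $\Delta$. All nodes start in the same slot, in the same state, and run the same randomised algorithm in synchronous slots; in each slot every node beeps or listens, and the random choices of distinct nodes (and of distinct slots) are independent. In the model $B_{cd}L$ a beeping node learns whether at least one of its neighbours beeps in the same slot, and a listening node learns whether at least one of its neighbours beeps. In $B_{cd}L_{cd}$ a listening node moreover distinguishes between no, exactly one, and at least two beeping neighbours. A node "perceives a beep" in a slot if it or one of its neighbours beeps in that slot. Doubling/halving. In all algorithms each node holds a probability $p$, initially $1/2$; to increase $p$ is to replace it by $\min(2p,1/2)$, to decrease $p$ is to replace it by $p/2$. Colouring algorithm (model $B_{cd}L$, one slot per phase). Each node is initially uncoloured and holds a counter, initially $0$. In each phase every uncoloured node beeps with probability $p$. If it beeped and no neighbour did, it takes the value of its counter as its colour and is passive from then on. Otherwise it increases $p$ if it perceived no beep, decreases $p$ if it perceived one, and increments its counter. 2-hop colouring algorithm (model $B_{cd}L_{cd}$, four slots per phase). Each node is initially uncoloured and holds a counter, initially $0$. Slot 1: every uncoloured node beeps with probability $p$. Slot 2: every node that heard at least two beeping neighbours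 in slot 1 beeps; a node that beeped alone in slot 1 and perceives no beep in slot 2 takes the value of its counter as its colour. Slot 3: every node that perceived a beep in slot 1 beeps; every uncoloured node increases $p$ if it perceived no beep in slots 1 and 3, and decreases $p$ otherwise. Slot 4: every uncoloured node beeps; a node that perceives no beep terminates. All nodes that have not terminated then increment their counters. Degree computation algorithm (model $B_{cd}L_{cd}$, five slots per phase). As in 2-hop colouring, with "uncounted/counted" in place of "uncoloured/coloured", but with a confirmation slot inserted after slot 2, in which each node that has just become counted beeps; each node that hears a beep in the confirmation slot increments its degree counter, which is initially $0$. Theorem. There is a function $\delta:\mathbb N\to\mathbb R$ with $\delta(n)=o(n^{-1})$ as $n\to\infty$ such that, for every finite simple graph $G$ with $n$ nodes and maximum degree $\Delta$, each of the following holds with probability at least $1-\delta(n)$: (1) within $\lfloor 20\Delta+180\ln n\rfloor=O(\Delta+\log n)$ phases, the colouring algorithm has coloured all nodes, and the colours form a proper colouring of $G$; (2) within $\lfloor 20\Delta^2+180\ln n\rfloor=O(\Delta^2+\log n)$ phases, all nodes have terminated in the 2-hop colouring algorithm, all are coloured, and any two distinct nodes at distance at most $2$ in $G$ have different colours; (3)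 within $\lfloor 20\Delta^2+180\ln n\rfloor=O(\Delta^2+\log n)$ phases, all nodes have terminated in the degree computation algorithm, and the degree counter of every node equals its degree in $G$. -/

import Mathlib

open scoped ENNReal

noncomputable section

namespace Beeping

/-! ### Beeping networks

All nodes run the same local randomised algorithm in synchronous slots. In each slot every node either
beeps or listens, and afterwards it perceives some information about the number of its neighbours that
beeped in that slot. -/

/-- What a node perceives in one slot in the model with collision detection on beeping only. -/
inductive ObsB
  | beepedAlone
  | beepedWithOthers
  | silence
  | heardBeep

/-- The model with collision detection on beeping only: perception of a node that beeps (`own = true`)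
or listens (`own = false`) while exactly `k` of its neighbours beep. -/
def perceiveB (own : Bool) (k : ℕ) : ObsB :=
  if own = true then
    if k = 0 then ObsB.beepedAlone else ObsB.beepedWithOthers
  else
    if k = 0 then ObsB.silence else ObsB.heardBeep

/-- What a node perceives in one slot in the model with collision detection on beeping and on
listening. -/
inductive ObsBL
  | beepedAlone
  | beepedWithOthers
  | silence
  | heardOne
  | heardSeveral
  deriving DecidableEq

/-- The model with collision detection on beeping and on listening: perception of a node that beeps
(`own = true`) or listens (`own = false`) while exactly `k` of its neighbours beep. -/
def perceiveBL (own : Bool) (k : ℕ) : ObsBL :=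
  if own = true then
    if k = 0 then ObsBL.beepedAlone else ObsBL.beepedWithOthers
  else
    if k = 0 then ObsBL.silence else if k = 1 then ObsBL.heardOne else ObsBL.heardSeveral

/-- A local randomised beeping algorithm with states `S` and perceptions `O`: the common initial state,
the probability of beeping in the next slot, and the state after a slot. -/
structure Algorithm (S O : Type) where
  init : S
  beepProb : S → unitInterval
  update : S → O → S

section Execution

variable {V : Type*} [Fintype V] [DecidableEq V]

/-- The joint law of the decisions to beep (`true`) or to listen (`false`) in one slot: node `v` beeps
with probability `p v`, independently of all other nodes. -/
def beepLaw (p : V → unitInterval) : PMF (V → Bool) :=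
  PMF.ofFintype
    (fun b => ∏ v, ENNReal.ofReal (if b v = true then (p v : ℝ) else 1 - (p v : ℝ)))
    (by
      have h := Finset.prod_univ_sum (ι := V) (κ := fun _ => Bool)
        (t := fun _ => (Finset.univ : Finset Bool))
        (f := fun v b => ENNReal.ofReal (if b = true then (p v : ℝ) else 1 - (p v : ℝ)))
      rw [Fintype.piFinset_univ] at h
      rw [← h]
      refine Finset.prod_eq_one fun v _ => ?_
      have h0 : (0 : ℝ) ≤ p v := (p v).2.1
      have h1 : (0 : ℝ) ≤ 1 - (p v : ℝ) := sub_nonneg.2 (p v).2.2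
      simp [← ENNReal.ofReal_add h0 h1])

/-- The number of neighbours of `v` that beep. -/
def beepingNeighbours (G : SimpleGraph V) [DecidableRel G.Adj] (b : V → Bool) (v : V) : ℕ :=
  (Finset.univ.filter fun u => G.Adj v u ∧ b u = true).card

/-- One slot of the execution of the algorithm `A` from the configuration `c`. -/
def slotStep {S O : Type} (A : Algorithm S O) (perceive : Bool → ℕ → O)
    (G : SimpleGraph V) [DecidableRel G.Adj] (c : V → S) : PMF (V → S) :=
  (beepLaw fun v => A.beepProb (c v)).map fun b v =>
    A.update (c v) (perceive (b v) (beepingNeighbours G b v))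

/-- The law of the configuration after `t` slots, all nodes having started in the initial state. -/
def run {S O : Type} (A : Algorithm S O) (perceive : Bool → ℕ → O)
    (G : SimpleGraph V) [DecidableRel G.Adj] : ℕ → PMF (V → S)
  | 0 => PMF.pure fun _ => A.init
  | t + 1 => (run A perceive G t).bind (slotStep A perceive G)

/-- The probability that the configuration after `t` slots satisfies `E`. -/
def probAfter {S O : Type} (A : Algorithm S O) (perceive : Bool → ℕ → O)
    (G : SimpleGraph V) [DecidableRel G.Adj] (t : ℕ) (E : (V → S) → Prop) : ℝ :=
  ((run A perceive G t).toOuterMeasure {c | E c}).toReal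

end Execution

/-! ### The doubling/halving adaptive probability -/

/-- The initial (and maximal) beeping probability. -/
def half : unitInterval := ⟨1 / 2, by norm_num, by norm_num⟩

/-- Increase of the beeping probability: doubling, up to `1/2`. -/
def increase (p : unitInterval) : unitInterval :=
  ⟨min (2 * (p : ℝ)) (1 / 2), le_min (mul_nonneg zero_le_two p.2.1) (by norm_num),
    (min_le_right _ _).trans (by norm_num)⟩

/-- Decrease of the beeping probability: halving. -/
def decrease (p : unitInterval) : unitInterval :=
  ⟨(p : ℝ) / 2, div_nonneg p.2.1 zero_le_two, by have := p.2.2; linarith⟩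

/-! ### Colouring without knowledge (one slot per phase) -/

/-- Local state of the colouring algorithm; `colour = none` means uncoloured. -/
structure ColState where
  p : unitInterval
  colour : Option ℕ
  counter : ℕ

/-- The colouring algorithm. A node that has taken a colour has terminated: it is passive from then
on. -/
def colouringAlg : Algorithm ColState ObsB where
  init := { p := half, colour := none, counter := 0 }
  beepProb s := if s.colour.isSome = true then 0 else s.p
  update s o :=
    if s.colour.isSome = true then s
    else match o with
      | ObsB.beepedAlone => { s with colour := some s.counter }
      | ObsB.silence => { s with p := increase s.p, counter := s.counter + 1 }
      | ObsB.beepedWithOthers => { s with p := decrease s.p, counter := s.counter + 1 }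
      | ObsB.heardBeep => { s with p := decrease s.p, counter := s.counter + 1 }

/-- Every node has a colour (hence has terminated), and the colours form a proper colouring of `G`. -/
def Coloured {V : Type*} (G : SimpleGraph V) (c : V → ColState) : Prop :=
  ∃ C : G.Coloring ℕ, ∀ v, (c v).colour = some (C v)

/-! ### 2-hop colouring (four slots per phase) -/

/-- The square of `G`: distinct nodes are adjacent if they are adjacent in `G` or have a common
neighbour in `G`. -/
def square {V : Type*} (G : SimpleGraph V) : SimpleGraph V where
  Adj u v := u ≠ v ∧ (G.Adj u v ∨ ∃ w, G.Adj u w ∧ G.Adj w v)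
  symm := ⟨fun _ _ h => ⟨h.1.symm, h.2.elim (fun h => Or.inl h.symm)
    fun ⟨w, h₁, h₂⟩ => Or.inr ⟨w, h₂.symm, h₁.symm⟩⟩⟩
  loopless := ⟨fun _ h => h.1 rfl⟩

/-- The slots of a phase of the 2-hop colouring algorithm. -/
inductive TwoHopSlot
  | contending
  | detection
  | adaptation
  | termination

/-- Local state of the 2-hop colouring algorithm. `obs` is what the node perceived in the contending
slot of the current phase, `slot` is the next slot, and `halted` says that the node has terminated. -/
structure TwoHopState where
  p : unitInterval
  colour : Option ℕ
  counter : ℕ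
  obs : ObsBL
  slot : TwoHopSlot
  halted : Bool

/-- The 2-hop colouring algorithm. A beep of the node itself counts as a beep, so that
`o = ObsBL.silence` says that neither the node nor any of its neighbours beeped. -/
def twoHopAlg : Algorithm TwoHopState ObsBL where
  init :=
    { p := half, colour := none, counter := 0, obs := ObsBL.silence,
      slot := TwoHopSlot.contending, halted := false }
  beepProb s :=
    if s.halted = true then 0
    else match s.slot with
      | TwoHopSlot.contending => if s.colour.isSome = true then 0 else s.p
      | TwoHopSlot.detection => if s.obs = ObsBL.heardSeveral then 1 else 0
      | TwoHopSlot.adaptation => if s.obs = ObsBL.silence then 0 else 1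
      | TwoHopSlot.termination => if s.colour.isSome = true then 0 else 1
  update s o :=
    if s.halted = true then s
    else match s.slot with
      | TwoHopSlot.contending => { s with obs := o, slot := TwoHopSlot.detection }
      | TwoHopSlot.detection =>
        { s with
          colour := if s.obs = ObsBL.beepedAlone ∧ o = ObsBL.silence then some s.counter
            else s.colour
          slot := TwoHopSlot.adaptation }
      | TwoHopSlot.adaptation =>
        { s with
          p := if s.colour.isSome = true then s.p
            else if s.obs = ObsBL.silence ∧ o = ObsBL.silence then increase s.p
            else decrease s.p
          slot := TwoHopSlot.termination }
      | TwoHopSlot.termination =>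
        { s with
          counter := s.counter + 1
          slot := TwoHopSlot.contending
          halted := decide (o = ObsBL.silence) }

/-- Every node has terminated with a colour, and the colours form a proper colouring of the square
of `G`. -/
def TwoHopColoured {V : Type*} (G : SimpleGraph V) (c : V → TwoHopState) : Prop :=
  (∀ v, (c v).halted = true) ∧ ∃ C : (square G).Coloring ℕ, ∀ v, (c v).colour = some (C v)

/-! ### Degree computation (five slots per phase) -/

/-- The slots of a phase of the degree computation algorithm. -/
inductive DegreeSlot
  | contending
  | detection
  | confirmation
  | adaptation
  | termination

/-- Local state of the degree computation algorithm. `counted` says that the node has produced a 2-hop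
exclusive beep, `excl` that it has done so in the current phase; `degree` is the number of confirmation
beeps heard so far; `obs`, `slot`, `halted` are as in 2-hop colouring. -/
structure DegreeState where
  p : unitInterval
  counted : Bool
  excl : Bool
  degree : ℕ
  obs : ObsBL
  slot : DegreeSlot
  halted : Bool

/-- The degree computation algorithm. -/
def degreeAlg : Algorithm DegreeState ObsBL where
  init :=
    { p := half, counted := false, excl := false, degree := 0, obs := ObsBL.silence,
      slot := DegreeSlot.contending, halted := false }
  beepProb s :=
    if s.halted = true then 0
    else match s.slot with
      | DegreeSlot.contending => if s.counted = true then 0 else s.p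
      | DegreeSlot.detection => if s.obs = ObsBL.heardSeveral then 1 else 0
      | DegreeSlot.confirmation => if s.excl = true then 1 else 0
      | DegreeSlot.adaptation => if s.obs = ObsBL.silence then 0 else 1
      | DegreeSlot.termination => if s.counted = true then 0 else 1
  update s o :=
    if s.halted = true then s
    else match s.slot with
      | DegreeSlot.contending => { s with obs := o, slot := DegreeSlot.detection }
      | DegreeSlot.detection =>
        { s with
          excl := decide (s.obs = ObsBL.beepedAlone ∧ o = ObsBL.silence)
          counted := s.counted || decide (s.obs = ObsBL.beepedAlone ∧ o = ObsBL.silence)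
          slot := DegreeSlot.confirmation }
      | DegreeSlot.confirmation =>
        { s with
          degree := if o = ObsBL.heardOne ∨ o = ObsBL.heardSeveral then s.degree + 1
            else s.degree
          slot := DegreeSlot.adaptation }
      | DegreeSlot.adaptation =>
        { s with
          p := if s.counted = true then s.p
            else if s.obs = ObsBL.silence ∧ o = ObsBL.silence then increase s.p
            else decrease s.p
          slot := DegreeSlot.termination }
      | DegreeSlot.termination =>
        { s with
          slot := DegreeSlot.contending
          halted := decide (o = ObsBL.silence) }

/-- Every node has terminated and has computed its degree in `G`. -/
def DegreesComputed {V : Type*} [Fintype V] (G : SimpleGraph V) [DecidableRel G.Adj]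
    (c : V → DegreeState) : Prop :=
  ∀ v, (c v).halted = true ∧ (c v).degree = G.degree v

/-- The number of phases `20 D + 180 ln n`, rounded down. -/
def phases (n D : ℕ) : ℕ :=
  ⌊20 * (D : ℝ) + 180 * Real.log (n : ℝ)⌋₊

end Beeping

end

/-! All three algorithms are one process: repeated rounds of contention on a graph `H`, equal to `G`
for colouring and to `square G` for the other two. In a round, an active node that beeps with no
beeping `H`-neighbour becomes inactive; other active nodes double `p` (capped at 1/2) if their
closed neighbourhood is silent and halve it otherwise.

To each active node `v` attach the potential `((4/3)^a)^(4/5) * (1+d)^(3/25) * (p⁻¹^(1/4))^(2/25)`,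
with `a` the number of active neighbours, `d` their total beeping probability and `p` the
probability of `v`; inactive nodes have potential 0. The exponents sum to 1, so by weighted AM-GM
the growth of the potential in a round is at most the same weighted average of the growth of the
three bases. In expectation (`expect_contraction_le`) the average is at most 79/80. Two effects
balance. Neighbours that retire shrink `a`, and a second-moment bound shows that this outweighs the
growth of `d` caused by neighbours in quiet surroundings. What remains depends on `d` only: if `d`
is large, it tends to halve; if `d` is small, `v` is likely to hear nothing, so its `p` doubles, or
is already near 1/2 and `v` has a good chance to retire.

Initially the potential is at most `200 exp(D/4)` when `H`-neighbourhoods have at most `D` elements,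
and an active node has potential at least 1. After `20 D + 180 ln n` rounds, Markov's inequality
leaves each node active with probability at most `600 n^(-9/4)`; the union bound gives `600 n^(-5/4)
= o(1/n)`. Correctness of the output is deterministic: an invariant holds at every configuration of
positive probability and gives the required output once all nodes are inactive (`le_probAfter`).

The algorithms are tied to contention by `PhaseContends`: only the first slot of a phase is random,
the later ones being functions of its beeps. For `square G`, a common neighbour relays what it
hears, which makes two-hop conflicts visible (`exclusive_iff`, `silent_iff`). -/

set_option linter.unusedSectionVars false

namespace Beeping

noncomputable section

/-! ### Expectations over independent beeps -/

section Expectation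

variable {V : Type*} [Fintype V] [DecidableEq V]

/-- The expectation of `f` when the nodes beep independently with probabilities `q`. -/
def expect (q : V → ℝ) (f : (V → Bool) → ℝ) : ℝ :=
  ∑ b, (∏ v, if b v = true then q v else 1 - q v) * f b

theorem expect_prod (q : V → ℝ) (g : V → Bool → ℝ) :
    expect q (fun b => ∏ v, g v (b v)) = ∏ v, (q v * g v true + (1 - q v) * g v false) := by
  have h := Finset.prod_univ_sum (ι := V) (κ := fun _ => Bool)
    (t := fun _ => (Finset.univ : Finset Bool))
    (f := fun v b => (if b = true then q v else 1 - q v) * g v b)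
  rw [Fintype.piFinset_univ] at h
  simp only [Fintype.sum_bool] at h
  rw [expect]
  simp only [← Finset.prod_mul_distrib]
  rw [← h]
  simp

theorem expect_add (q : V → ℝ) (f g : (V → Bool) → ℝ) :
    expect q (fun b => f b + g b) = expect q f + expect q g := by
  simp [expect, mul_add, Finset.sum_add_distrib]

theorem expect_const_mul (q : V → ℝ) (a : ℝ) (f : (V → Bool) → ℝ) :
    expect q (fun b => a * f b) = a * expect q f := by
  simp only [expect, Finset.mul_sum]
  exact Finset.sum_congr rfl fun b _ => by ring

theorem expect_sum {ι : Type*} (q : V → ℝ) (s : Finset ι) (f : ι → (V → Bool) → ℝ) :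
    expect q (fun b => ∑ i ∈ s, f i b) = ∑ i ∈ s, expect q (f i) := by
  simp only [expect, Finset.mul_sum]
  exact Finset.sum_comm

theorem expect_const (q : V → ℝ) (a : ℝ) : expect q (fun _ => a) = a := by
  have h := expect_prod q (fun _ _ => 1)
  have h' := expect_const_mul q a (fun _ => 1)
  simp only [Finset.prod_const_one, mul_one, add_sub_cancel] at h h'
  rw [h', h, mul_one]

/-- Patterns in which a node of probability 0 beeps have weight 0, so the comparison may assume that
inactive nodes are silent. -/
theorem expect_mono {q : V → ℝ} (h0 : ∀ v, 0 ≤ q v) (h1 : ∀ v, q v ≤ 1)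
    {f g : (V → Bool) → ℝ} (h : ∀ b, (∀ v, b v = true → q v ≠ 0) → f b ≤ g b) :
    expect q f ≤ expect q g := by
  refine Finset.sum_le_sum fun b _ => ?_
  by_cases hb : ∀ v, b v = true → q v ≠ 0
  · refine mul_le_mul_of_nonneg_left (h b hb) (Finset.prod_nonneg fun v _ => ?_)
    split_ifs
    · exact h0 v
    · linarith [h1 v]
  · push Not at hb
    obtain ⟨v, hv, hq⟩ := hb
    have : (∏ v, if b v = true then q v else 1 - q v) = 0 :=
      Finset.prod_eq_zero (Finset.mem_univ v) (by simp [hv, hq])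
    simp [this]

/-- The indicator of the event that all nodes in `S` beep and no node in `T` does. -/
def pattern (S T : Finset V) (b : V → Bool) : ℝ :=
  if (∀ v ∈ S, b v = true) ∧ (∀ v ∈ T, b v = false) then 1 else 0

theorem expect_pattern (q : V → ℝ) {S T : Finset V} (hST : Disjoint S T) :
    expect q (pattern S T) = (∏ v ∈ S, q v) * ∏ v ∈ T, (1 - q v) := by
  have h := expect_prod q (fun v β => (if v ∈ S then (if β = true then 1 else 0) else 1) *
    (if v ∈ T then (if β = false then 1 else 0) else 1))
  have h1 : (fun b : V → Bool => ∏ v, ((if v ∈ S then (if b v = true then (1 : ℝ) else 0) else 1) *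
      (if v ∈ T then (if b v = false then 1 else 0) else 1))) = pattern S T := by
    funext b
    rw [Finset.prod_mul_distrib, Finset.prod_ite_mem, Finset.prod_ite_mem, Finset.univ_inter,
      Finset.univ_inter, Finset.prod_boole, Finset.prod_boole, pattern,
      ite_zero_mul_ite_zero, mul_one]
    congr
  rw [← h1, h, ← Finset.univ_inter S, ← Finset.univ_inter T, ← Finset.prod_ite_mem,
    ← Finset.prod_ite_mem, ← Finset.prod_mul_distrib]
  refine Finset.prod_congr rfl fun v _ => ?_
  by_cases hS : v ∈ S
  · have hT : v ∉ T := Finset.disjoint_left.1 hST hS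
    simp [hS, hT]
  · by_cases hT : v ∈ T <;> simp [hS, hT]

end Expectation

/-! ### The one-round inequality -/

section OneStep

variable {V : Type*} [Fintype V] [DecidableEq V]

open Classical in
/-- The neighbourhood of `v`. -/
def nbhd (H : SimpleGraph V) (v : V) : Finset V := Finset.univ.filter (H.Adj v)

theorem mem_nbhd {H : SimpleGraph V} {u v : V} : u ∈ nbhd H v ↔ H.Adj v u := by simp [nbhd]

/-- The indicator of the event that no neighbour of `v` beeps. -/
def quiet (H : SimpleGraph V) (v : V) (b : V → Bool) : ℝ := pattern ∅ (nbhd H v) b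

/-- The indicator of the event that `v` beeps and no neighbour of `v` does. -/
def alone (H : SimpleGraph V) (v : V) (b : V → Bool) : ℝ := pattern {v} (nbhd H v) b

/-- The probability that no neighbour of `v` beeps. -/
def quietProb (H : SimpleGraph V) (q : V → ℝ) (v : V) : ℝ := ∏ u ∈ nbhd H v, (1 - q u)

variable (H : SimpleGraph V) (q : V → ℝ)

theorem expect_quiet (v : V) : expect q (quiet H v) = quietProb H q v := by
  unfold quiet
  rw [expect_pattern q (Finset.disjoint_empty_left _)]
  simp [quietProb]

theorem expect_alone (v : V) : expect q (alone H v) = q v * quietProb H q v := by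
  unfold alone
  rw [expect_pattern q (by simp [mem_nbhd])]
  simp [quietProb]

variable {q}

theorem quietProb_nonneg (h1 : ∀ v, q v ≤ 1) (v : V) : 0 ≤ quietProb H q v :=
  Finset.prod_nonneg fun u _ => by linarith [h1 u]

/-- The union bound, in the form of Weierstrass' product inequality. -/
theorem one_sub_sum_le_quietProb (h0 : ∀ v, 0 ≤ q v) (h1 : ∀ v, q v ≤ 1) (v : V) :
    1 - ∑ u ∈ nbhd H v, q u ≤ quietProb H q v := by
  unfold quietProb
  generalize nbhd H v = s
  induction s using Finset.induction_on with
  | empty => simp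
  | insert a s ha ih =>
    rw [Finset.sum_insert ha, Finset.prod_insert ha]
    have hs : ∏ u ∈ s, (1 - q u) ≤ 1 :=
      Finset.prod_le_one (fun u _ => by linarith [h1 u]) fun u _ => by linarith [h0 u]
    nlinarith [h0 a, h1 a]

theorem pattern_nonneg (S T : Finset V) (b : V → Bool) : 0 ≤ pattern S T b := by
  unfold pattern; split_ifs <;> norm_num

/-- Adjacent nodes cannot both beep alone. For non-adjacent ones, dropping the condition on the
neighbours of `w` leaves the beep of `w`, which is independent of `u` beeping alone. -/
theorem expect_alone_mul_alone_le (h0 : ∀ v, 0 ≤ q v) (h1 : ∀ v, q v ≤ 1) {u w : V}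
    (huw : u ≠ w) :
    expect q (fun b => alone H u b * alone H w b) ≤ q w * (q u * quietProb H q u) := by
  by_cases hadj : w ∈ nbhd H u
  · have : (fun b => alone H u b * alone H w b) = fun _ => 0 := by
      funext b
      unfold alone pattern
      by_cases hu : (∀ x ∈ ({u} : Finset V), b x = true) ∧ ∀ x ∈ nbhd H u, b x = false
      · have := hu.2 w hadj
        simp [this]
      · simp only [if_neg hu, zero_mul]
    rw [this, expect_const]
    exact mul_nonneg (h0 w) (mul_nonneg (h0 u) (quietProb_nonneg H h1 u))
  · have hd : Disjoint ({u, w} : Finset V) (nbhd H u) := by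
      simp [hadj, mem_nbhd]
    have h := expect_pattern q hd
    rw [Finset.prod_pair huw] at h
    calc expect q (fun b => alone H u b * alone H w b)
        ≤ expect q (pattern {u, w} (nbhd H u)) := by
          refine expect_mono h0 h1 fun b _ => ?_
          unfold alone pattern
          by_cases hu : (∀ x ∈ ({u} : Finset V), b x = true) ∧ ∀ x ∈ nbhd H u, b x = false
          · by_cases hw : (∀ x ∈ ({w} : Finset V), b x = true) ∧ ∀ x ∈ nbhd H w, b x = false
            · have : (∀ x ∈ ({u, w} : Finset V), b x = true) ∧ ∀ x ∈ nbhd H u, b x = false := by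
                refine ⟨fun x hx => ?_, hu.2⟩
                rcases Finset.mem_insert.1 hx with rfl | hx
                · exact hu.1 _ (by simp)
                · exact hw.1 _ hx
              rw [if_pos hu, if_pos hw, if_pos this, one_mul]
            · rw [if_neg hw, mul_zero]
              split_ifs <;> norm_num
          · rw [if_neg hu, zero_mul]
            split_ifs <;> norm_num
      _ = q w * (q u * quietProb H q u) := by rw [h, quietProb]; ring

theorem alone_mul_self (u : V) (b : V → Bool) : alone H u b * alone H u b = alone H u b := by
  unfold alone pattern; split_ifs <;> norm_num

/-- Second moment of the number of neighbours of `v` that beep alone. -/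
theorem expect_sq_sum_alone_le (h0 : ∀ v, 0 ≤ q v) (h1 : ∀ v, q v ≤ 1) (s : Finset V) :
    expect q (fun b => (∑ u ∈ s, alone H u b) ^ 2) ≤
      (∑ u ∈ s, q u * quietProb H q u) * (1 + ∑ u ∈ s, q u) := by
  have h : (fun b : V → Bool => (∑ u ∈ s, alone H u b) ^ 2) =
      fun b => ∑ u ∈ s, ∑ w ∈ s, alone H u b * alone H w b := by
    funext b; rw [sq, Finset.sum_mul_sum]
  rw [h, expect_sum, Finset.sum_mul]
  refine Finset.sum_le_sum fun u hu => ?_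
  rw [expect_sum]
  have hW : 0 ≤ q u * quietProb H q u := mul_nonneg (h0 u) (quietProb_nonneg H h1 u)
  -- Indicators are idempotent, so the diagonal term is a first moment; it is given a superfluous
  -- nonnegative summand to make the sum uniform in `w`.
  calc ∑ w ∈ s, expect q (fun b => alone H u b * alone H w b)
      ≤ ∑ w ∈ s, ((if u = w then q u * quietProb H q u else 0) +
          q w * (q u * quietProb H q u)) := by
        refine Finset.sum_le_sum fun w _ => ?_
        by_cases huw : u = w
        · subst huw
          simp only [alone_mul_self, if_true]
          rw [show (fun b => alone H u b) = alone H u from rfl, expect_alone]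
          linarith [mul_nonneg (h0 u) hW]
        · rw [if_neg huw, zero_add]
          exact expect_alone_mul_alone_le H h0 h1 huw
    _ = q u * quietProb H q u * (1 + ∑ w ∈ s, q w) := by
        rw [Finset.sum_add_distrib, Finset.sum_ite_eq, if_pos hu, ← Finset.sum_mul]; ring

/-- The one-step contraction, in terms of indicators. -/
theorem expect_contraction_le (h0 : ∀ v, 0 ≤ q v) (h1 : ∀ v, q v ≤ 1) (v : V)
    {d : ℝ} (hd : d = ∑ u ∈ nbhd H v, q u) {Z : (V → Bool) → ℝ}
    (hZ : expect q Z ≤ 119 / 100 - 349 / 1000 * quietProb H q v) :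
    expect q (fun b =>
      4 / 5 * (1 - 1 / 4 * (2 * (1 + d)⁻¹ * ∑ u ∈ nbhd H v, alone H u b -
        (1 + d)⁻¹ ^ 2 * (∑ u ∈ nbhd H v, alone H u b) ^ 2)) +
      3 / 25 * ((1 + ∑ u ∈ nbhd H v, q u * (1 / 2 + 3 / 2 * quiet H u b)) * (1 + d)⁻¹) +
      2 / 25 * Z b) ≤ 79 / 80 := by
  set W := ∑ u ∈ nbhd H v, q u * quietProb H q u with hW
  have hd0 : 0 ≤ d := hd ▸ Finset.sum_nonneg fun u _ => h0 u
  have hW0 : 0 ≤ W := Finset.sum_nonneg fun u _ => mul_nonneg (h0 u) (quietProb_nonneg H h1 u)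
  set t := (1 + d)⁻¹ with ht
  have ht0 : 0 < t := by positivity
  have htd : t * (1 + d) = 1 := inv_mul_cancel₀ (by positivity)
  have hM : expect q (fun b => ∑ u ∈ nbhd H v, alone H u b) = W := by
    rw [expect_sum]
    exact Finset.sum_congr rfl fun u _ => expect_alone H q u
  have hM2 := expect_sq_sum_alone_le H h0 h1 (nbhd H v)
  rw [← hd, ← hW] at hM2
  have hQ : expect q (fun b => ∑ u ∈ nbhd H v, q u * quiet H u b) = W := by
    rw [expect_sum]
    refine Finset.sum_congr rfl fun u _ => ?_
    rw [expect_const_mul]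
    exact congrArg _ (expect_quiet H q u)
  have hexp : expect q (fun b =>
      4 / 5 * (1 - 1 / 4 * (2 * t * ∑ u ∈ nbhd H v, alone H u b -
        t ^ 2 * (∑ u ∈ nbhd H v, alone H u b) ^ 2)) +
      3 / 25 * ((1 + ∑ u ∈ nbhd H v, q u * (1 / 2 + 3 / 2 * quiet H u b)) * t) +
      2 / 25 * Z b) =
      (4 / 5 + 3 / 25 * t * (1 + d / 2)) + ((-(2 / 5) * t) * W +
        ((1 / 5 * t ^ 2) * expect q (fun b => (∑ u ∈ nbhd H v, alone H u b) ^ 2) +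
        ((9 / 50 * t) * W + 2 / 25 * expect q Z))) := by
    have : (fun b =>
      4 / 5 * (1 - 1 / 4 * (2 * t * ∑ u ∈ nbhd H v, alone H u b -
        t ^ 2 * (∑ u ∈ nbhd H v, alone H u b) ^ 2)) +
      3 / 25 * ((1 + ∑ u ∈ nbhd H v, q u * (1 / 2 + 3 / 2 * quiet H u b)) * t) +
      2 / 25 * Z b) = fun b => (4 / 5 + 3 / 25 * t * (1 + d / 2)) +
        ((-(2 / 5) * t) * (∑ u ∈ nbhd H v, alone H u b) +
        ((1 / 5 * t ^ 2) * ((∑ u ∈ nbhd H v, alone H u b) ^ 2) +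
        ((9 / 50 * t) * (∑ u ∈ nbhd H v, q u * quiet H u b) + 2 / 25 * Z b))) := by
      funext b
      have : ∑ u ∈ nbhd H v, q u * (1 / 2 + 3 / 2 * quiet H u b) =
          d / 2 + 3 / 2 * ∑ u ∈ nbhd H v, q u * quiet H u b := by
        rw [hd, Finset.sum_div, Finset.mul_sum, ← Finset.sum_add_distrib]
        exact Finset.sum_congr rfl fun u _ => by ring
      rw [this]; ring
    rw [this, expect_add, expect_const, expect_add, expect_const_mul, hM, expect_add,
      expect_const_mul, expect_add, expect_const_mul, hQ, expect_const_mul]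
  rw [hexp]
  -- The choice `t = 1/(1+d)` cancels the factor `1 + d` of the second moment, which thus costs only
  -- half of the gain `2/5 * t * W` from the first moment.
  have hM2' : (1 / 5 * t ^ 2) * expect q (fun b => (∑ u ∈ nbhd H v, alone H u b) ^ 2) ≤
      1 / 5 * t * W := by
    calc _ ≤ (1 / 5 * t ^ 2) * (W * (1 + d)) := mul_le_mul_of_nonneg_left hM2 (by positivity)
      _ = 1 / 5 * t * W * (t * (1 + d)) := by ring
      _ = _ := by rw [htd, mul_one]
  have hq0 := quietProb_nonneg H h1 v
  have hq1 := one_sub_sum_le_quietProb H h0 h1 v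
  rw [← hd] at hq1
  have htW : 0 ≤ t * W := by positivity
  -- The terms free of `W`. For `d ≤ 1`, silence has probability at least `1 - d`, and the worst
  -- case is `d = 0`; for `d ≥ 1`, the smallness of `t` suffices without any silence.
  have key : 3 / 25 * t * (1 + d / 2) + 2 / 25 * (119 / 100 - 349 / 1000 * quietProb H q v) ≤
      79 / 80 - 4 / 5 := by
    have e : t * (1 + d / 2) = 1 / 2 + t / 2 := by linear_combination htd / 2
    rw [mul_assoc, e]
    rcases le_total d 1 with h | h
    · have : t ≤ 1 - d / 2 := by
        rw [ht, inv_le_iff_one_le_mul₀ (by positivity)]; nlinarith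
      linarith
    · have : t ≤ 1 / 2 := by
        rw [ht, inv_le_comm₀ (by positivity) (by norm_num)]; linarith
      linarith
  -- The coefficient of `t * W` is `-2/5 + 1/5 + 9/50 = -1/50`, so these terms can be dropped.
  nlinarith

end OneStep

/-! ### Contention rounds and the contraction of the potential -/

section Potential

variable {V : Type*} [Fintype V] [DecidableEq V]

/-- The part of a local state on which the contention between the nodes depends. -/
structure Contender where
  p : unitInterval
  active : Bool

/-- The probability with which a contender beeps. -/
def contendProb (x : Contender) : unitInterval := if x.active = true then x.p else 0

open Classical in
/-- The result of one round of contention on the graph `H`. -/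
def contend (H : SimpleGraph V) (x : V → Contender) (b : V → Bool) (v : V) : Contender :=
  if (x v).active = false then x v
  else if ∃ u, H.Adj v u ∧ b u = true then ⟨decrease (x v).p, true⟩
  else if b v = true then ⟨(x v).p, false⟩
  else ⟨increase (x v).p, true⟩

section Cases

variable {H : SimpleGraph V} {x : V → Contender} {b : V → Bool} {v : V}

theorem contend_of_inactive (h : (x v).active = false) : contend H x b v = x v := by
  simp [contend, h]

theorem contend_of_noisy (h : (x v).active = true) (hn : ∃ u, H.Adj v u ∧ b u = true) :
    contend H x b v = ⟨decrease (x v).p, true⟩ := by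
  rw [contend, if_neg (by simp [h]), if_pos hn]

theorem contend_of_alone (h : (x v).active = true) (hn : ¬∃ u, H.Adj v u ∧ b u = true)
    (hb : b v = true) : contend H x b v = ⟨(x v).p, false⟩ := by
  rw [contend, if_neg (by simp [h]), if_neg hn, if_pos hb]

theorem contend_of_silent (h : (x v).active = true) (hn : ¬∃ u, H.Adj v u ∧ b u = true)
    (hb : b v = false) : contend H x b v = ⟨increase (x v).p, true⟩ := by
  rw [contend, if_neg (by simp [h]), if_neg hn, if_neg (by simp [hb])]

theorem quiet_of_noisy (hn : ∃ u, H.Adj v u ∧ b u = true) : quiet H v b = 0 := by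
  rw [quiet, pattern, if_neg]
  rintro ⟨-, h'⟩
  obtain ⟨u, hu, hb⟩ := hn
  simp [h' u (mem_nbhd.2 hu)] at hb

theorem quiet_of_not_noisy (hn : ¬∃ u, H.Adj v u ∧ b u = true) : quiet H v b = 1 := by
  rw [quiet, pattern, if_pos]
  push Not at hn
  exact ⟨by simp, fun u hu => by simpa using hn u (mem_nbhd.1 hu)⟩

theorem alone_eq : alone H v b = if b v = true then quiet H v b else 0 := by
  unfold alone quiet pattern
  by_cases h : b v = true <;> simp only [Finset.mem_singleton, forall_eq, h] <;> simp

end Cases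

/-- All beeping probabilities are positive and at most `1/2`. -/
def ProbBounds (x : V → Contender) : Prop := ∀ v, 0 < ((x v).p : ℝ) ∧ ((x v).p : ℝ) ≤ 1 / 2

theorem ProbBounds.contend {H : SimpleGraph V} {x : V → Contender} (hx : ProbBounds x)
    (b : V → Bool) : ProbBounds (contend H x b) := by
  intro v
  have := hx v
  unfold Beeping.contend
  split_ifs
  · exact this
  · simp only [decrease]; constructor <;> linarith
  · exact this
  · simp only [increase]
    exact ⟨lt_min (by linarith) (by norm_num), min_le_right _ _⟩

/-- The total beeping probability of the neighbours of `v`. -/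
def load (H : SimpleGraph V) (x : V → Contender) (v : V) : ℝ :=
  ∑ u ∈ nbhd H v, (contendProb (x u) : ℝ)

/-- The number of active neighbours of `v`. -/
def activeCount (H : SimpleGraph V) (x : V → Contender) (v : V) : ℕ :=
  ((nbhd H v).filter fun u => (x u).active = true).card

/-- The potential of the node `v`. -/
def potential (H : SimpleGraph V) (v : V) (x : V → Contender) : ℝ :=
  if (x v).active = true then
    ((4 / 3 : ℝ) ^ activeCount H x v) ^ (4 / 5 : ℝ) * (1 + load H x v) ^ (3 / 25 : ℝ) *
      (((x v).p : ℝ)⁻¹ ^ (1 / 4 : ℝ)) ^ (2 / 25 : ℝ)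
  else 0

variable (H : SimpleGraph V)

theorem load_nonneg (x : V → Contender) (v : V) : 0 ≤ load H x v :=
  Finset.sum_nonneg fun u _ => (contendProb (x u)).2.1

theorem potential_nonneg (v : V) (x : V → Contender) : 0 ≤ potential H v x := by
  unfold potential
  have := load_nonneg H x v
  have := (x v).p.2.1
  split_ifs <;> positivity

theorem one_le_potential {v : V} {x : V → Contender} (hx : ProbBounds x)
    (hv : (x v).active = true) : 1 ≤ potential H v x := by
  rw [potential, if_pos hv]
  have h1 : 1 ≤ ((4 / 3 : ℝ) ^ activeCount H x v) ^ (4 / 5 : ℝ) :=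
    Real.one_le_rpow (one_le_pow₀ (by norm_num)) (by norm_num)
  have h2 : 1 ≤ (1 + load H x v) ^ (3 / 25 : ℝ) :=
    Real.one_le_rpow (by linarith [load_nonneg H x v]) (by norm_num)
  have h3 : 1 ≤ (((x v).p : ℝ)⁻¹ ^ (1 / 4 : ℝ)) ^ (2 / 25 : ℝ) :=
    Real.one_le_rpow (Real.one_le_rpow ((one_le_inv₀ (hx v).1).2 (by linarith [(hx v).2]))
      (by norm_num)) (by norm_num)
  exact one_le_mul_of_one_le_of_one_le (one_le_mul_of_one_le_of_one_le h1 h2) h3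

/-- The factor is 1/2 when a neighbour of `u` beeps and 2 otherwise. In the latter case it is only
an upper bound: the probability is capped, or drops to 0 if `u` retires. -/
theorem contendProb_contend_le {x : V → Contender} (b : V → Bool) (u : V) :
    (contendProb (contend H x b u) : ℝ) ≤
      (contendProb (x u) : ℝ) * (1 / 2 + 3 / 2 * quiet H u b) := by
  have h0 : (0 : ℝ) ≤ (x u).p := (x u).p.2.1
  by_cases ha : (x u).active = true
  · by_cases hq : ∃ w, H.Adj u w ∧ b w = true
    · rw [contend_of_noisy ha hq, quiet_of_noisy hq]
      simp only [contendProb, ha, decrease, if_true]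
      linarith
    · rw [quiet_of_not_noisy hq]
      cases hu : b u
      · rw [contend_of_silent ha hq hu]
        simp only [contendProb, ha, increase, if_true]
        exact (min_le_left _ _).trans (by linarith)
      · rw [contend_of_alone ha hq hu]
        simp only [contendProb, ha, if_true]
        simp
        linarith
  · rw [contend_of_inactive (by simpa using ha)]
    simp [contendProb, ha]

/-- The nodes that retire are exactly those that beep alone. Only active nodes may beep here, as
otherwise an inactive node could be counted as retiring. -/
theorem activeCount_contend {x : V → Contender} {b : V → Bool}
    (hb : ∀ u, b u = true → (x u).active = true) (v : V) :
    (activeCount H x v : ℝ) =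
      activeCount H (contend H x b) v + ∑ u ∈ nbhd H v, alone H u b := by
  simp only [activeCount, Finset.card_filter, Nat.cast_sum]
  rw [← Finset.sum_add_distrib]
  refine Finset.sum_congr rfl fun u _ => ?_
  rw [alone_eq]
  by_cases ha : (x u).active = true
  · by_cases hq : ∃ w, H.Adj u w ∧ b w = true
    · rw [contend_of_noisy ha hq, quiet_of_noisy hq]
      simp [ha]
    · rw [quiet_of_not_noisy hq]
      cases hu : b u
      · rw [contend_of_silent ha hq hu]
        simp [ha]
      · rw [contend_of_alone ha hq hu]
        simp [ha]
  · have hu : b u = false := by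
      by_contra h; exact ha (hb u (by simpa using h))
    rw [contend_of_inactive (by simpa using ha)]
    simp [ha, hu]

theorem load_contend_le {x : V → Contender} (b : V → Bool) (v : V) :
    load H (contend H x b) v ≤
      ∑ u ∈ nbhd H v, (contendProb (x u) : ℝ) * (1 / 2 + 3 / 2 * quiet H u b) :=
  Finset.sum_le_sum fun u _ => contendProb_contend_le H b u

/-- Weighted AM-GM turns the product of growth factors into a sum whose expectation can be computed.
The fourth power of `z` matches the root `p⁻¹^(1/4)` in the potential. If `v` retires its new
potential is 0, so `z` is constrained only while `v` stays active. -/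
theorem potential_contend_le {x : V → Contender} (hx : ProbBounds x) {b : V → Bool}
    (hb : ∀ u, b u = true → (x u).active = true) {v : V} {z : ℝ} (hz0 : 0 ≤ z)
    (hz : (contend H x b v).active = true →
      ((contend H x b v).p : ℝ)⁻¹ ≤ ((x v).p : ℝ)⁻¹ * z ^ 4) (hv : (x v).active = true) :
    potential H v (contend H x b) ≤ potential H v x *
      (4 / 5 * (1 - 1 / 4 * (2 * (1 + load H x v)⁻¹ * ∑ u ∈ nbhd H v, alone H u b -
        (1 + load H x v)⁻¹ ^ 2 * (∑ u ∈ nbhd H v, alone H u b) ^ 2)) +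
      3 / 25 * ((1 + ∑ u ∈ nbhd H v, (contendProb (x u) : ℝ) * (1 / 2 + 3 / 2 * quiet H u b)) *
        (1 + load H x v)⁻¹) +
      2 / 25 * z) := by
  have hd := load_nonneg H x v
  have hd' := (load_nonneg H (contend H x b) v).trans (load_contend_le H (x := x) b v)
  have hp := (hx v).1
  set a := activeCount H x v with ha
  set a' := activeCount H (contend H x b) v with ha'
  set d := load H x v
  set N := ∑ u ∈ nbhd H v, alone H u b with hN
  set d' := ∑ u ∈ nbhd H v, (contendProb (x u) : ℝ) * (1 / 2 + 3 / 2 * quiet H u b)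
  have hact : (a : ℝ) = a' + N := activeCount_contend H hb v
  have hN0 : 0 ≤ N := Finset.sum_nonneg fun u _ => pattern_nonneg _ _ _
  have haa : a' ≤ a := by exact_mod_cast (by linarith : (a' : ℝ) ≤ a)
  obtain ⟨m, hm⟩ := Nat.exists_eq_add_of_le haa
  have hNm : N = m := by rw [hm] at hact; push_cast at hact; linarith
  -- A quadratic majorant of `(3/4)^N`, chosen so that first and second moments suffice: the bracket
  -- is `1 - (1 - N/(1+d))^2`, which is at most 1, and it vanishes at `N = 0`.
  have hX : (3 / 4 : ℝ) ^ m ≤ 1 - 1 / 4 * (2 * (1 + d)⁻¹ * N - (1 + d)⁻¹ ^ 2 * N ^ 2) := by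
    rcases Nat.eq_zero_or_pos m with h | h
    · rw [hNm, h]; norm_num
    · have h1 : (3 / 4 : ℝ) ^ m ≤ 3 / 4 := pow_le_of_le_one (by norm_num) (by norm_num) h.ne'
      nlinarith [sq_nonneg (1 - (1 + d)⁻¹ * N)]
  have hX0 : (0 : ℝ) ≤ 1 - 1 / 4 * (2 * (1 + d)⁻¹ * N - (1 + d)⁻¹ ^ 2 * N ^ 2) :=
    (by positivity : (0 : ℝ) ≤ (3 / 4) ^ m).trans hX
  set X := 1 - 1 / 4 * (2 * (1 + d)⁻¹ * N - (1 + d)⁻¹ ^ 2 * N ^ 2)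
  set r := (1 + d') * (1 + d)⁻¹ with hr
  have hr0 : 0 ≤ r := by positivity
  have hΦ := potential_nonneg H v x
  by_cases hv' : (contend H x b v).active = true
  · have hp' := (hx.contend (H := H) b v).1
    have e1 : (4 / 3 : ℝ) ^ a' = (4 / 3) ^ a * (3 / 4) ^ m := by
      rw [hm, pow_add, mul_assoc, ← mul_pow]; norm_num
    have e3 : ((contend H x b v).p : ℝ)⁻¹ ^ (1 / 4 : ℝ) ≤ ((x v).p : ℝ)⁻¹ ^ (1 / 4 : ℝ) * z := by
      calc _ ≤ (((x v).p : ℝ)⁻¹ * z ^ 4) ^ (1 / 4 : ℝ) :=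
            Real.rpow_le_rpow (by positivity) (hz hv') (by norm_num)
        _ = _ := by
            rw [Real.mul_rpow (by positivity) (by positivity), ← Real.rpow_natCast,
              ← Real.rpow_mul hz0]
            norm_num
    calc potential H v (contend H x b)
        ≤ ((4 / 3 : ℝ) ^ a * X) ^ (4 / 5 : ℝ) * ((1 + d) * r) ^ (3 / 25 : ℝ) *
          (((x v).p : ℝ)⁻¹ ^ (1 / 4 : ℝ) * z) ^ (2 / 25 : ℝ) := by
          rw [potential, if_pos hv', ← ha', e1]
          have e2 : 1 + load H (contend H x b) v ≤ (1 + d) * r := by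
            rw [hr, mul_comm (1 + d'), mul_inv_cancel_left₀ (by positivity)]
            linarith [load_contend_le H (x := x) b v]
          have := load_nonneg H (contend H x b) v
          gcongr
      _ = potential H v x * (X ^ (4 / 5 : ℝ) * r ^ (3 / 25 : ℝ) * z ^ (2 / 25 : ℝ)) := by
          rw [potential, if_pos hv, Real.mul_rpow (by positivity) hX0,
            Real.mul_rpow (by positivity) hr0, Real.mul_rpow (by positivity) hz0]
          ring
      _ ≤ _ := by
          refine mul_le_mul_of_nonneg_left ?_ hΦ
          exact Real.geom_mean_le_arith_mean3_weighted (by norm_num) (by norm_num) (by norm_num)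
            hX0 hr0 hz0 (by norm_num)
  · rw [potential, if_neg hv']
    exact mul_nonneg hΦ (by positivity)

/-- The potential of a node contracts in expectation. -/
theorem expect_potential_le {x : V → Contender} (hx : ProbBounds x) (v : V) :
    expect (fun u => (contendProb (x u) : ℝ)) (fun b => potential H v (contend H x b)) ≤
      79 / 80 * potential H v x := by
  classical
  set q : V → ℝ := fun u => (contendProb (x u) : ℝ) with hq
  have h0 : ∀ u, 0 ≤ q u := fun u => (contendProb (x u)).2.1
  have h1 : ∀ u, q u ≤ 1 := fun u => (contendProb (x u)).2.2
  by_cases hv : (x v).active = true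
  · have hp := (hx v).1
    have hp2 := (hx v).2
    -- It remains to choose the growth factor `Z` of `p⁻¹^(1/4)`, differently for small and for
    -- large `p`.
    have key : ∀ Z : (V → Bool) → ℝ,
        expect q Z ≤ 119 / 100 - 349 / 1000 * quietProb H q v →
        (∀ b, 0 ≤ Z b ∧ ((contend H x b v).active = true →
          ((contend H x b v).p : ℝ)⁻¹ ≤ ((x v).p : ℝ)⁻¹ * Z b ^ 4)) →
        expect q (fun b => potential H v (contend H x b)) ≤ 79 / 80 * potential H v x := by
      intro Z hZ hZb
      have hc := expect_contraction_le H h0 h1 v (d := load H x v) rfl hZ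
      have hm := mul_le_mul_of_nonneg_left hc (potential_nonneg H v x)
      rw [← expect_const_mul] at hm
      refine (expect_mono h0 h1 fun b hb => ?_).trans (hm.trans (le_of_eq (mul_comm _ _)))
      refine potential_contend_le H hx (fun u hu => ?_) (hZb b).1 (hZb b).2 hv
      by_contra h
      exact hb u hu (by simp [hq, contendProb, h])
    have hi : ∀ {s t : ℝ}, 0 < t → (x v).p * t⁻¹ ≤ s → t⁻¹ ≤ ((x v).p : ℝ)⁻¹ * s := by
      intro s t _ h
      rw [← div_eq_inv_mul, le_div_iff₀ hp, mul_comm]; exact h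
    -- Halving `p` doubles `p⁻¹`, and `1.19^4` is just above 2.
    have hnoisy : ((decrease (x v).p : unitInterval) : ℝ)⁻¹ ≤ ((x v).p : ℝ)⁻¹ * (119 / 100) ^ 4 := by
      refine hi (by simp only [decrease]; positivity) ?_
      simp only [decrease]
      rw [inv_div, mul_div_cancel₀ _ hp.ne']; norm_num
    by_cases h4 : ((x v).p : ℝ) ≤ 1 / 4
    -- Here doubling is not capped. On silence the factor is `1.19 - 0.349 = 0.841`, whose fourth
    -- power is just above 1/2.
    · refine key (fun b => 119 / 100 + -(349 / 1000) * quiet H v b) ?_ fun b => ?_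
      · rw [expect_add, expect_const, expect_const_mul]
        refine le_of_eq ?_
        linear_combination -(349 / 1000) * expect_quiet H q v
      · by_cases hn : ∃ u, H.Adj v u ∧ b u = true
        · rw [contend_of_noisy hv hn, quiet_of_noisy hn, mul_zero, add_zero]
          exact ⟨by norm_num, fun _ => hnoisy⟩
        · rw [quiet_of_not_noisy hn]
          refine ⟨by norm_num, ?_⟩
          cases hbv : b v
          · rw [contend_of_silent hv hn hbv]
            have e : ((increase (x v).p : unitInterval) : ℝ) = 2 * (x v).p :=
              min_eq_left (by linarith)
            intro _
            simp only [e]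
            refine hi (by positivity) ?_
            rw [mul_inv, mul_left_comm, mul_inv_cancel₀ hp.ne']; norm_num
          · rw [contend_of_alone hv hn hbv]
            simp
    -- Here doubling is capped, so silence gives only the factor 1. In exchange `v` beeps with
    -- probability above 1/4, and beeping alone gives the factor 0; since `0.19 + 1/4 ≥ 0.349`, the
    -- same bound on the expectation holds.
    · refine key (fun b => 119 / 100 + (-(19 / 100) * quiet H v b + -1 * alone H v b)) ?_
        fun b => ?_
      · rw [expect_add, expect_const, expect_add, expect_const_mul, expect_const_mul]
        have e1 : expect q (fun b => quiet H v b) = quietProb H q v := expect_quiet H q v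
        have e2 : expect q (fun b => alone H v b) = q v * quietProb H q v := expect_alone H q v
        have e3 : q v = (x v).p := by simp [hq, contendProb, hv]
        rw [e1, e2, e3]
        nlinarith [quietProb_nonneg H h1 v]
      · rw [alone_eq]
        by_cases hn : ∃ u, H.Adj v u ∧ b u = true
        · rw [contend_of_noisy hv hn, quiet_of_noisy hn, ite_self, mul_zero, mul_zero, add_zero,
            add_zero]
          exact ⟨by norm_num, fun _ => hnoisy⟩
        · rw [quiet_of_not_noisy hn]
          cases hbv : b v
          · rw [contend_of_silent hv hn hbv]
            have e : ((increase (x v).p : unitInterval) : ℝ) = 1 / 2 :=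
              min_eq_right (by linarith)
            refine ⟨by norm_num, fun _ => ?_⟩
            simp only [e]
            exact hi (by positivity) (by norm_num; linarith)
          · rw [contend_of_alone hv hn hbv]
            norm_num
  · have : (fun b => potential H v (contend H x b)) = fun _ => 0 := by
      funext b
      rw [potential, if_neg]
      simp [contend, hv]
    rw [this, expect_const, potential, if_neg hv, mul_zero]

end Potential

/-! ### From contraction to a bound on the failure probability -/

section Run

variable {V : Type*} [Fintype V] [DecidableEq V]

theorem beepLaw_apply_eq (p : V → unitInterval) (b : V → Bool) :
    beepLaw p b = ENNReal.ofReal (∏ v, if b v = true then (p v : ℝ) else 1 - (p v : ℝ)) := by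
  rw [beepLaw, PMF.ofFintype_apply, ENNReal.ofReal_prod_of_nonneg]
  intro v _
  split_ifs
  · exact (p v).2.1
  · exact sub_nonneg.2 (p v).2.2

theorem feasible_of_beepLaw_ne_zero {p : V → unitInterval} {b : V → Bool}
    (hb : beepLaw p b ≠ 0) (v : V) : if b v = true then p v ≠ 0 else p v ≠ 1 := by
  rw [beepLaw, PMF.ofFintype_apply] at hb
  have h := Finset.prod_ne_zero_iff.1 hb v (Finset.mem_univ v)
  split_ifs with hv <;> intro h' <;> simp [hv, h'] at h

theorem tsum_beepLaw_mul (p : V → unitInterval) {f : (V → Bool) → ℝ} (hf : ∀ b, 0 ≤ f b) :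
    ∑' b, beepLaw p b * ENNReal.ofReal (f b) =
      ENNReal.ofReal (expect (fun v => (p v : ℝ)) f) := by
  rw [tsum_fintype, expect, ENNReal.ofReal_sum_of_nonneg]
  · refine Finset.sum_congr rfl fun b _ => ?_
    rw [beepLaw_apply_eq, ← ENNReal.ofReal_mul']
    exact hf b
  · intro b _
    refine mul_nonneg (Finset.prod_nonneg fun v _ => ?_) (hf b)
    split_ifs
    · exact (p v).2.1
    · exact sub_nonneg.2 (p v).2.2

theorem tsum_map_mul {α β : Type*} (μ : PMF α) (f : α → β) (g : β → ℝ≥0∞) :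
    ∑' b, (μ.map f) b * g b = ∑' a, μ a * g (f a) := by
  classical
  simp only [PMF.map_apply, ← ENNReal.tsum_mul_right]
  rw [ENNReal.tsum_comm]
  refine tsum_congr fun a => ?_
  rw [tsum_eq_single (f a)]
  · simp
  · intro b hb
    simp [hb]

theorem tsum_bind_mul {α β : Type*} (μ : PMF α) (κ : α → PMF β) (g : β → ℝ≥0∞) :
    ∑' b, (μ.bind κ) b * g b = ∑' a, μ a * ∑' b, κ a b * g b := by
  simp only [PMF.bind_apply, ← ENNReal.tsum_mul_right, ← ENNReal.tsum_mul_left]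
  rw [ENNReal.tsum_comm]
  simp only [mul_assoc]

/-- The law of the configuration after `L` slots of the execution from the configuration `c`. -/
def slots {S O : Type} (A : Algorithm S O) (perceive : Bool → ℕ → O)
    (G : SimpleGraph V) [DecidableRel G.Adj] : ℕ → (V → S) → PMF (V → S)
  | 0, c => PMF.pure c
  | L + 1, c => (slots A perceive G L c).bind (slotStep A perceive G)

theorem run_add {S O : Type} (A : Algorithm S O) (perceive : Bool → ℕ → O)
    (G : SimpleGraph V) [DecidableRel G.Adj] (s L : ℕ) :
    run A perceive G (s + L) = (run A perceive G s).bind (slots A perceive G L) := by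
  induction L with
  | zero =>
    have : slots A perceive G 0 = PMF.pure := rfl
    rw [this, PMF.bind_pure, add_zero]
  | succ L ih =>
    rw [← add_assoc, run, ih, PMF.bind_bind]
    rfl

/-- After one phase of length `L` from the configuration `c`, the contenders described by `proj` have
contended once on `H`, and `Inv` holds. -/
def PhaseContends {S O : Type} (A : Algorithm S O) (perceive : Bool → ℕ → O)
    (G : SimpleGraph V) [DecidableRel G.Adj] (L : ℕ) (H : SimpleGraph V) (proj : S → Contender)
    (Inv : (V → S) → Prop) (c : V → S) : Prop :=
  ∃ f : (V → Bool) → V → S,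
    slots A perceive G L c = (beepLaw fun v => contendProb (proj (c v))).map f ∧
    ∀ b, (∀ v, b v = true → (proj (c v)).active = true) →
      Inv (f b) ∧ ∀ v, proj (f b v) = contend H (fun u => proj (c u)) b v

section General

variable {S O : Type} {A : Algorithm S O} {perceive : Bool → ℕ → O}
  {G : SimpleGraph V} [DecidableRel G.Adj] {L : ℕ} {H : SimpleGraph V} {proj : S → Contender}
  {Inv : ℕ → (V → S) → Prop}

theorem active_of_beepLaw_ne_zero {x : V → Contender} {b : V → Bool}
    (hb : beepLaw (fun v => contendProb (x v)) b ≠ 0) (v : V) (hv : b v = true) :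
    (x v).active = true := by
  by_contra h
  have := feasible_of_beepLaw_ne_zero hb v
  rw [if_pos hv] at this
  exact this (by simp [contendProb, h])

/-- Induction along the support: every reachable configuration arises from a reachable one by a
feasible beep pattern. -/
theorem invariant_of_run_ne_zero (h0 : Inv 0 fun _ => A.init) (hp0 : proj A.init = ⟨half, true⟩)
    (hstep : ∀ t c, Inv t c → PhaseContends A perceive G L H proj (Inv (t + 1)) c)
    (t : ℕ) (c : V → S) (hc : run A perceive G (L * t) c ≠ 0) :
    Inv t c ∧ ProbBounds fun v => proj (c v) := by
  induction t generalizing c with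
  | zero =>
    have hc' : c = fun _ => A.init := by
      by_contra h
      exact hc (by simp [run, h])
    subst hc'
    refine ⟨h0, fun v => ?_⟩
    simp only [hp0, half]
    norm_num
  | succ t ih =>
    rw [mul_add, mul_one, run_add, ← PMF.mem_support_iff, PMF.mem_support_bind_iff] at hc
    obtain ⟨c', hc', hcc⟩ := hc
    obtain ⟨hI, hP⟩ := ih c' ((PMF.mem_support_iff _ _).1 hc')
    obtain ⟨f, hf, hfb⟩ := hstep t c' hI
    rw [hf, PMF.mem_support_map_iff] at hcc
    obtain ⟨b, hb, rfl⟩ := hcc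
    have hb' := active_of_beepLaw_ne_zero ((PMF.mem_support_iff _ _).1 hb)
    refine ⟨(hfb b hb').1, ?_⟩
    have : (fun v => proj (f b v)) = contend H (fun u => proj (c' u)) b :=
      funext (hfb b hb').2
    rw [this]
    exact hP.contend b

/-- Iterated contraction of the expected potential. Configurations and patterns of probability 0,
where neither the invariant nor the link to contention is available, contribute nothing and are
split off. -/
theorem tsum_run_potential_le (h0 : Inv 0 fun _ => A.init)
    (hp0 : proj A.init = ⟨half, true⟩)
    (hstep : ∀ t c, Inv t c → PhaseContends A perceive G L H proj (Inv (t + 1)) c)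
    (t : ℕ) (v : V) :
    ∑' c, run A perceive G (L * t) c * ENNReal.ofReal (potential H v fun u => proj (c u)) ≤
      ENNReal.ofReal ((79 / 80) ^ t * potential H v fun _ => ⟨half, true⟩) := by
  induction t with
  | zero =>
    rw [mul_zero, run, tsum_eq_single (fun _ => A.init)]
    · simp [hp0]
    · intro c hc
      simp [hc]
  | succ t ih =>
    rw [mul_add, mul_one, run_add, tsum_bind_mul]
    have hle : ∀ c, run A perceive G (L * t) c *
        (∑' c', slots A perceive G L c c' *
          ENNReal.ofReal (potential H v fun u => proj (c' u))) ≤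
        ENNReal.ofReal (79 / 80) * (run A perceive G (L * t) c *
          ENNReal.ofReal (potential H v fun u => proj (c u))) := by
      intro c
      by_cases hc : run A perceive G (L * t) c = 0
      · simp [hc]
      obtain ⟨hI, hP⟩ := invariant_of_run_ne_zero h0 hp0 hstep t c hc
      obtain ⟨f, hf, hfb⟩ := hstep t c hI
      rw [mul_left_comm, ← ENNReal.ofReal_mul (by norm_num)]
      refine mul_le_mul_right ?_ _
      rw [hf, tsum_map_mul]
      have : ∀ b, (beepLaw fun v => contendProb (proj (c v))) b *
          ENNReal.ofReal (potential H v fun u => proj (f b u)) =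
          (beepLaw fun v => contendProb (proj (c v))) b *
          ENNReal.ofReal (potential H v (contend H (fun u => proj (c u)) b)) := by
        intro b
        by_cases hb : (beepLaw fun v => contendProb (proj (c v))) b = 0
        · simp [hb]
        · have := (hfb b (active_of_beepLaw_ne_zero hb)).2
          rw [show (fun v => proj (f b v)) = contend H (fun u => proj (c u)) b from funext this]
      rw [tsum_congr this, tsum_beepLaw_mul _ fun b => potential_nonneg H v _]
      exact ENNReal.ofReal_le_ofReal (expect_potential_le H hP v)
    refine (ENNReal.tsum_le_tsum hle).trans ?_
    rw [ENNReal.tsum_mul_left]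
    refine (mul_le_mul_right ih _).trans (le_of_eq ?_)
    rw [← ENNReal.ofReal_mul (by norm_num), pow_succ]
    ring_nf

/-- The exponent is `1/4 = 6/25 + 1/100`: the first part comes from `4/3 ≤ exp(3/10)` raised to the
power 4/5, the second absorbs the linear growth of the load at the price of the constant 100. -/
theorem potential_initial_le {D : ℕ} (hD : ∀ v, (nbhd H v).card ≤ D) (v : V) :
    potential H v (fun _ => ⟨half, true⟩) ≤ 200 * Real.exp (D / 4) := by
  have hcard : ((nbhd H v).card : ℝ) ≤ D := by exact_mod_cast hD v
  have hload : load H (fun _ => ⟨half, true⟩) v = (nbhd H v).card / 2 := by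
    simp [load, contendProb, half, div_eq_mul_inv]
  have hact : activeCount H (fun _ => (⟨half, true⟩ : Contender)) v = (nbhd H v).card := by
    simp [activeCount]
  rw [potential, if_pos rfl, hload, hact]
  have h1 : ((4 / 3 : ℝ) ^ (nbhd H v).card) ^ (4 / 5 : ℝ) ≤ Real.exp (6 / 25 * D) := by
    have e : (4 / 3 : ℝ) ≤ Real.exp (3 / 10) := by
      have := Real.quadratic_le_exp_of_nonneg (x := 3 / 10) (by norm_num)
      norm_num at this ⊢
      linarith
    calc ((4 / 3 : ℝ) ^ (nbhd H v).card) ^ (4 / 5 : ℝ)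
        ≤ (Real.exp (3 / 10) ^ D) ^ (4 / 5 : ℝ) := by
          have := hD v
          refine Real.rpow_le_rpow (by positivity) ?_ (by norm_num)
          calc (4 / 3 : ℝ) ^ (nbhd H v).card ≤ (4 / 3 : ℝ) ^ D :=
                pow_le_pow_right₀ (by norm_num) this
            _ ≤ _ := by gcongr
      _ = Real.exp (6 / 25 * D) := by
          rw [← Real.exp_nat_mul, ← Real.exp_mul]; congr 1; ring
  have h2 : (1 + ((nbhd H v).card : ℝ) / 2) ^ (3 / 25 : ℝ) ≤ 100 * Real.exp (D / 100) := by
    have e : 1 + ((nbhd H v).card : ℝ) / 2 ≤ 100 * Real.exp (D / 100) := by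
      have := Real.add_one_le_exp ((D : ℝ) / 100)
      have h0 : (0 : ℝ) ≤ D := Nat.cast_nonneg D
      linarith
    calc _ ≤ (1 + ((nbhd H v).card : ℝ) / 2) ^ (1 : ℝ) :=
          Real.rpow_le_rpow_of_exponent_le (by linarith [Nat.cast_nonneg (α := ℝ) (nbhd H v).card])
            (by norm_num)
      _ ≤ _ := by rwa [Real.rpow_one]
  have h3 : ((((half : unitInterval) : ℝ))⁻¹ ^ (1 / 4 : ℝ)) ^ (2 / 25 : ℝ) ≤ 2 := by
    rw [← Real.rpow_mul (by simp [half])]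
    have : ((half : unitInterval) : ℝ)⁻¹ = 2 := by simp [half]
    rw [this]
    calc (2 : ℝ) ^ (1 / 4 * (2 / 25) : ℝ) ≤ 2 ^ (1 : ℝ) :=
          Real.rpow_le_rpow_of_exponent_le (by norm_num) (by norm_num)
      _ = 2 := Real.rpow_one 2
  have hh : (0 : ℝ) ≤ ((half : unitInterval) : ℝ) := half.2.1
  calc _ ≤ Real.exp (6 / 25 * D) * (100 * Real.exp (D / 100)) * 2 := by gcongr
    _ = 200 * (Real.exp (6 / 25 * D) * Real.exp (D / 100)) := by ring
    _ = 200 * Real.exp (D / 4) := by rw [← Real.exp_add]; congr 2; ring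

/-- `79/80 ≤ exp(-1/80)`, so `20 D` phases cancel `exp(D/4)` and `180 ln n` phases give `n^(-9/4)`.
Rounding down the number of phases costs less than a factor `e < 3`, whence 600. -/
theorem pow_phases_mul_le {n : ℕ} (hn : 0 < n) (D : ℕ) :
    (79 / 80 : ℝ) ^ phases n D * (200 * Real.exp (D / 4)) ≤ 600 * (n : ℝ) ^ (-(9 / 4) : ℝ) := by
  have hn' : (0 : ℝ) < n := by exact_mod_cast hn
  have h1 : (79 / 80 : ℝ) ^ phases n D ≤ Real.exp (-(phases n D : ℝ) / 80) := by
    have e : (79 / 80 : ℝ) ≤ Real.exp (-1 / 80) := by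
      have := Real.add_one_le_exp (-1 / 80 : ℝ)
      linarith
    calc _ ≤ Real.exp (-1 / 80) ^ phases n D := by gcongr
      _ = _ := by rw [← Real.exp_nat_mul]; congr 1; ring
  have h2 : 20 * (D : ℝ) + 180 * Real.log n < phases n D + 1 := Nat.lt_floor_add_one _
  rw [Real.rpow_def_of_pos hn']
  calc _ ≤ Real.exp (-(phases n D : ℝ) / 80) * (200 * Real.exp (D / 4)) := by gcongr
    _ = 200 * Real.exp (-(phases n D : ℝ) / 80 + D / 4) := by rw [Real.exp_add]; ring
    _ ≤ 200 * Real.exp (1 + Real.log n * -(9 / 4)) := by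
        refine mul_le_mul_of_nonneg_left (Real.exp_le_exp.2 ?_) (by norm_num)
        linarith
    _ ≤ 600 * Real.exp (Real.log n * -(9 / 4)) := by
        rw [Real.exp_add, ← mul_assoc]
        gcongr
        linarith [Real.exp_one_lt_d9]

/-- Markov's inequality and a union bound over the nodes. This is the common conclusion for the
three algorithms; each has to supply only its invariant and `PhaseContends`. -/
theorem le_probAfter (h0 : Inv 0 fun _ => A.init) (hp0 : proj A.init = ⟨half, true⟩)
    (hstep : ∀ t c, Inv t c → PhaseContends A perceive G L H proj (Inv (t + 1)) c)
    {D : ℕ} (hD : ∀ v, (nbhd H v).card ≤ D) {E : (V → S) → Prop}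
    (hE : ∀ t c, Inv t c → (∀ v, (proj (c v)).active = false) → E c) :
    1 - 600 * (Fintype.card V : ℝ) ^ (-(5 / 4) : ℝ) ≤
      probAfter A perceive G (L * phases (Fintype.card V) D) E := by
  classical
  set n := Fintype.card V with hn
  set T := phases n D
  set μ := run A perceive G (L * T)
  set ε : ℝ := 600 * (n : ℝ) ^ (-(9 / 4) : ℝ) with hε
  have hε0 : 0 ≤ ε := by positivity
  have hv : ∀ v : V, ∑' c, μ c * ENNReal.ofReal (potential H v fun u => proj (c u)) ≤
      ENNReal.ofReal ε := fun v => by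
    refine (tsum_run_potential_le h0 hp0 hstep T v).trans (ENNReal.ofReal_le_ofReal ?_)
    refine (mul_le_mul_of_nonneg_left (potential_initial_le hD v) (by positivity)).trans ?_
    exact pow_phases_mul_le (Fintype.card_pos_iff.2 ⟨v⟩) D
  -- A reachable configuration outside `E` has an active node, whose potential is at least 1 and
  -- pays for its mass.
  have hpt : ∀ c, μ c ≤ Set.indicator {c | E c} μ c +
      ∑ v, μ c * ENNReal.ofReal (potential H v fun u => proj (c u)) := by
    intro c
    by_cases hc : μ c = 0
    · simp [hc]
    obtain ⟨hI, hP⟩ := invariant_of_run_ne_zero h0 hp0 hstep T c hc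
    by_cases hE' : E c
    · rw [Set.indicator_of_mem (show c ∈ {c | E c} from hE')]
      exact le_self_add
    · have : ∃ v, (proj (c v)).active = true := by
        by_contra h
        push Not at h
        exact hE' (hE T c hI fun v => by simpa using h v)
      obtain ⟨v, hv⟩ := this
      have h1 := ENNReal.ofReal_le_ofReal (one_le_potential H hP hv)
      rw [ENNReal.ofReal_one] at h1
      calc μ c = μ c * 1 := (mul_one _).symm
        _ ≤ μ c * ENNReal.ofReal (potential H v fun u => proj (c u)) := mul_le_mul_right h1 _
        _ ≤ ∑ v, μ c * ENNReal.ofReal (potential H v fun u => proj (c u)) :=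
            Finset.single_le_sum (f := fun v => μ c *
              ENNReal.ofReal (potential H v fun u => proj (c u))) (fun _ _ => zero_le)
              (Finset.mem_univ v)
        _ ≤ _ := le_add_self
  have hsum : (1 : ℝ≥0∞) ≤ μ.toOuterMeasure {c | E c} + ENNReal.ofReal (n * ε) := by
    calc (1 : ℝ≥0∞) = ∑' c, μ c := μ.tsum_coe.symm
      _ ≤ ∑' c, (Set.indicator {c | E c} μ c +
          ∑ v, μ c * ENNReal.ofReal (potential H v fun u => proj (c u))) :=
          ENNReal.tsum_le_tsum hpt
      _ = μ.toOuterMeasure {c | E c} +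
          ∑ v, ∑' c, μ c * ENNReal.ofReal (potential H v fun u => proj (c u)) := by
          rw [ENNReal.tsum_add, PMF.toOuterMeasure_apply,
            Summable.tsum_finsetSum fun _ _ => ENNReal.summable]
      _ ≤ μ.toOuterMeasure {c | E c} + ∑ _v : V, ENNReal.ofReal ε := by
          gcongr with v
          exact hv v
      _ = _ := by
          rw [Finset.sum_const, Finset.card_univ, nsmul_eq_mul,
            ENNReal.ofReal_mul (Nat.cast_nonneg _), ENNReal.ofReal_natCast]
  have hfin : μ.toOuterMeasure {c | E c} ≠ ⊤ := by
    rw [PMF.toOuterMeasure_apply]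
    refine ne_top_of_le_ne_top ENNReal.one_ne_top ?_
    rw [← μ.tsum_coe]
    exact ENNReal.tsum_le_tsum fun c => Set.indicator_le_self' (fun _ _ => zero_le) c
  have hreal := ENNReal.toReal_mono (ENNReal.add_ne_top.2 ⟨hfin, ENNReal.ofReal_ne_top⟩) hsum
  rw [ENNReal.toReal_add hfin ENNReal.ofReal_ne_top, ENNReal.toReal_one,
    ENNReal.toReal_ofReal (by positivity)] at hreal
  have hnε : (n : ℝ) * ε ≤ 600 * (n : ℝ) ^ (-(5 / 4) : ℝ) := by
    rcases Nat.eq_zero_or_pos n with h | h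
    · rw [h, Nat.cast_zero, zero_mul]; positivity
    · have hn0 : (0 : ℝ) < n := by exact_mod_cast h
      refine le_of_eq ?_
      rw [hε, mul_left_comm]
      congr 1
      rw [← Real.rpow_one_add' hn0.le (by norm_num)]
      norm_num
  show _ ≤ (μ.toOuterMeasure {c | E c}).toReal
  linarith

end General

end Run

/-! ### Slots without randomness -/

section Slots

variable {V : Type*} [Fintype V] [DecidableEq V]

theorem beepLaw_of_deterministic {p : V → unitInterval} {d : V → Bool}
    (h : ∀ v, p v = if d v = true then 1 else 0) : beepLaw p = PMF.pure d := by
  ext b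
  by_cases hb : b = d
  · subst hb
    rw [PMF.pure_apply_self, beepLaw_apply_eq, Finset.prod_eq_one, ENNReal.ofReal_one]
    intro v _
    rw [h v]
    cases b v <;> simp
  · rw [PMF.pure_apply_of_ne _ _ hb]
    by_contra hne
    refine hb (funext fun v => ?_)
    have := feasible_of_beepLaw_ne_zero hne v
    rw [h v] at this
    cases hbv : b v <;> cases hdv : d v <;> simp [hbv, hdv] at this ⊢

variable {S O : Type} {A : Algorithm S O} {perceive : Bool → ℕ → O}
  {G : SimpleGraph V} [DecidableRel G.Adj]

theorem slots_one (c : V → S) :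
    slots A perceive G 1 c = (beepLaw fun v => A.beepProb (c v)).map fun b v =>
      A.update (c v) (perceive (b v) (beepingNeighbours G b v)) := by
  simp only [slots, PMF.pure_bind]
  rfl

/-- If after every pattern `b` each node beeps with probability 0 or 1 in the next slot, that slot
adds no randomness, and the law remains an image of the law of `b`. -/
theorem slots_succ_of_deterministic {L : ℕ} {c : V → S} {μ : PMF (V → Bool)}
    {f g : (V → Bool) → V → S} {d : (V → Bool) → V → Bool}
    (hf : slots A perceive G L c = μ.map f)
    (hd : ∀ b v, A.beepProb (f b v) = if d b v = true then 1 else 0)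
    (hg : ∀ b v, A.update (f b v) (perceive (d b v) (beepingNeighbours G (d b) v)) = g b v) :
    slots A perceive G (L + 1) c = μ.map g := by
  rw [slots, hf, PMF.bind_map, ← PMF.bind_pure_comp]
  congr 1
  funext b
  simp only [Function.comp, slotStep]
  rw [beepLaw_of_deterministic (hd b), PMF.pure_map]
  congr 1
  funext v
  exact hg b v

theorem beepingNeighbours_eq_zero {b : V → Bool} {v : V} :
    beepingNeighbours G b v = 0 ↔ ¬∃ u, G.Adj v u ∧ b u = true := by
  simp [beepingNeighbours, Finset.card_eq_zero, Finset.filter_eq_empty_iff]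

theorem two_le_beepingNeighbours {b : V → Bool} {v : V} :
    2 ≤ beepingNeighbours G b v ↔
      ∃ u w, u ≠ w ∧ G.Adj v u ∧ G.Adj v w ∧ b u = true ∧ b w = true := by
  rw [beepingNeighbours, ← Nat.lt_iff_add_one_le, Finset.one_lt_card_iff]
  simp only [Finset.mem_filter, Finset.mem_univ, true_and]
  constructor
  · rintro ⟨u, w, h1, h2, h3⟩
    exact ⟨u, w, h3, h1.1, h2.1, h1.2, h2.2⟩
  · rintro ⟨u, w, h1, h2, h3, h4, h5⟩
    exact ⟨u, w, ⟨h2, h4⟩, ⟨h3, h5⟩, h1⟩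

end Slots

/-! ### Colouring -/

section Colour

variable {V : Type*} [Fintype V] [DecidableEq V]

/-- The partial colouring at the start of phase `t`: it is proper on `H`, and its colours are
numbers of earlier phases. -/
structure PartialColouring (H : SimpleGraph V) (t : ℕ) (colour : V → Option ℕ)
    (counter : V → ℕ) : Prop where
  counter_eq : ∀ v, colour v = none → counter v = t
  lt : ∀ v a, colour v = some a → a < t
  proper : ∀ u v a, H.Adj u v → colour u = some a → colour v ≠ some a

theorem PartialColouring.init (H : SimpleGraph V) :
    PartialColouring H 0 (fun _ => none) fun _ => 0 :=
  ⟨fun _ _ => rfl, fun _ _ h => by simp at h, fun _ _ _ _ h => by simp at h⟩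

/-- A new colour is the current phase number `t`, which differs from all older colours, and two
neighbours cannot both beep alone in one phase. Used with `H = G` and with `H = square G`. -/
theorem PartialColouring.step {H : SimpleGraph V} {t : ℕ} {colour colour' : V → Option ℕ}
    {counter counter' : V → ℕ} (h : PartialColouring H t colour counter) {b : V → Bool}
    (hb : ∀ v, b v = true → colour v = none)
    (halone : ∀ v, b v = true → (¬∃ u, H.Adj v u ∧ b u = true) → colour' v = some (counter v))
    (hother : ∀ v, ¬(b v = true ∧ ¬∃ u, H.Adj v u ∧ b u = true) → colour' v = colour v)
    (hcounter : ∀ v, colour' v = none → counter' v = counter v + 1) :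
    PartialColouring H (t + 1) colour' counter' := by
  have key : ∀ v a, colour' v = some a →
      (colour v = some a ∧ a < t) ∨
        (a = t ∧ b v = true ∧ ¬∃ u, H.Adj v u ∧ b u = true) := by
    intro v a hv
    by_cases hav : b v = true ∧ ¬∃ u, H.Adj v u ∧ b u = true
    · right
      rw [halone v hav.1 hav.2, h.counter_eq v (hb v hav.1), Option.some_inj] at hv
      exact ⟨hv.symm, hav⟩
    · left
      rw [hother v hav] at hv
      exact ⟨hv, h.lt v a hv⟩
  refine ⟨fun v hv => ?_, fun v a hv => ?_, fun u v a huv hu hv => ?_⟩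
  · rw [hcounter v hv, h.counter_eq v]
    by_cases hav : b v = true ∧ ¬∃ u, H.Adj v u ∧ b u = true
    · exact hb v hav.1
    · rw [← hother v hav, hv]
  · rcases key v a hv with h' | h' <;> omega
  · rcases key u a hu with h1 | h1 <;> rcases key v a hv with h2 | h2
    · exact h.proper u v a huv h1.1 h2.1
    · omega
    · omega
    · exact h1.2.2 ⟨v, huv, h2.2.1⟩

theorem PartialColouring.exists_coloring {H : SimpleGraph V} {t : ℕ} {colour : V → Option ℕ}
    {counter : V → ℕ} (h : PartialColouring H t colour counter) (hc : ∀ v, colour v ≠ none) :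
    ∃ C : H.Coloring ℕ, ∀ v, colour v = some (C v) := by
  choose C hC using fun v => Option.ne_none_iff_exists'.1 (hc v)
  refine ⟨SimpleGraph.Coloring.mk C fun {u v} huv he => ?_, hC⟩
  exact h.proper u v (C u) huv (hC u) (he ▸ hC v)

variable {G : SimpleGraph V} [DecidableRel G.Adj]

/-- The colouring algorithm as a contention. -/
def ColState.contender (s : ColState) : Contender := ⟨s.p, s.colour.isNone⟩

theorem colouring_phaseContends (t : ℕ) (c : V → ColState)
    (hc : PartialColouring G t (fun v => (c v).colour) fun v => (c v).counter) :
    PhaseContends colouringAlg perceiveB G 1 G ColState.contender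
      (fun c => PartialColouring G (t + 1) (fun v => (c v).colour) fun v => (c v).counter) c := by
  refine ⟨fun b v => colouringAlg.update (c v) (perceiveB (b v) (beepingNeighbours G b v)),
    (slots_one c).trans ?_, fun b hb => ?_⟩
  · congr 2
    funext v
    simp only [colouringAlg, contendProb, ColState.contender]
    by_cases h : (c v).colour = none <;> simp [h, Option.isSome_iff_ne_none]
  have hb' : ∀ v, b v = true → (c v).colour = none := fun v hv => by
    simpa [ColState.contender] using hb v hv
  -- These are the four branches of `contend`: inactive, noisy, alone, silent.
  have hcases : ∀ v,
      ((c v).colour ≠ none ∧ colouringAlg.update (c v)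
        (perceiveB (b v) (beepingNeighbours G b v)) = c v) ∨
      ((c v).colour = none ∧ (∃ u, G.Adj v u ∧ b u = true) ∧ colouringAlg.update (c v)
        (perceiveB (b v) (beepingNeighbours G b v)) =
          { c v with p := decrease (c v).p, counter := (c v).counter + 1 }) ∨
      ((c v).colour = none ∧ (¬∃ u, G.Adj v u ∧ b u = true) ∧ b v = true ∧
        colouringAlg.update (c v) (perceiveB (b v) (beepingNeighbours G b v)) =
          { c v with colour := some (c v).counter }) ∨
      ((c v).colour = none ∧ (¬∃ u, G.Adj v u ∧ b u = true) ∧ b v = false ∧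
        colouringAlg.update (c v) (perceiveB (b v) (beepingNeighbours G b v)) =
          { c v with p := increase (c v).p, counter := (c v).counter + 1 }) := by
    intro v
    by_cases hv : (c v).colour = none
    · right
      by_cases hn : ∃ u, G.Adj v u ∧ b u = true
      · left
        have : ¬beepingNeighbours G b v = 0 := fun h => beepingNeighbours_eq_zero.1 h hn
        refine ⟨hv, hn, ?_⟩
        cases hbv : b v <;> simp [colouringAlg, perceiveB, hv, this]
      · right
        have := beepingNeighbours_eq_zero.2 hn
        cases hbv : b v
        · right; exact ⟨hv, hn, rfl, by simp [colouringAlg, perceiveB, hv, this]⟩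
        · left; exact ⟨hv, hn, rfl, by simp [colouringAlg, perceiveB, hv, this]⟩
    · left
      exact ⟨hv, by simp [colouringAlg, Option.isSome_iff_ne_none, hv]⟩
  beta_reduce
  refine ⟨hc.step hb' (fun v hbv hn => ?_) (fun v hv => ?_) (fun v hv => ?_), fun v => ?_⟩
  · rcases hcases v with h | h | h | h
    · exact absurd (hb' v hbv) h.1
    · exact absurd h.2.1 hn
    · rw [h.2.2.2]
    · simp [hbv] at h
  · rcases hcases v with h | h | h | h
    · rw [h.2]
    · rw [h.2.2]
    · exact absurd ⟨h.2.2.1, h.2.1⟩ hv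
    · rw [h.2.2.2]
  · rcases hcases v with h | h | h | h
    · rw [h.2] at hv; exact absurd hv h.1
    · rw [h.2.2]
    · rw [h.2.2.2] at hv; simp at hv
    · rw [h.2.2.2]
  · have hact : (c v).colour = none → (c v).contender.active = true := fun h => by
      simp [ColState.contender, h]
    rcases hcases v with h | h | h | h
    · rw [h.2, contend_of_inactive]
      simpa [ColState.contender, Option.isSome_iff_ne_none] using h.1
    · rw [h.2.2, contend_of_noisy (x := fun u => (c u).contender) (hact h.1) h.2.1]
      simp [ColState.contender, h.1]
    · rw [h.2.2.2, contend_of_alone (x := fun u => (c u).contender) (hact h.1) h.2.1 h.2.2.1]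
      simp [ColState.contender]
    · rw [h.2.2.2, contend_of_silent (x := fun u => (c u).contender) (hact h.1) h.2.1 h.2.2.1]
      simp [ColState.contender, h.1]

theorem card_nbhd (v : V) : (nbhd G v).card = G.degree v := by
  rw [← SimpleGraph.card_neighborFinset_eq_degree]
  congr 1
  ext u
  simp [mem_nbhd]

theorem le_probAfter_coloured :
    1 - 600 * (Fintype.card V : ℝ) ^ (-(5 / 4) : ℝ) ≤
      probAfter colouringAlg perceiveB G (phases (Fintype.card V) G.maxDegree) (Coloured G) := by
  have := le_probAfter (A := colouringAlg) (perceive := perceiveB) (G := G) (L := 1) (H := G)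
    (proj := ColState.contender)
    (Inv := fun t c => PartialColouring G t (fun v => (c v).colour) fun v => (c v).counter)
    (E := Coloured G)
    (PartialColouring.init G) rfl colouring_phaseContends
    (fun v => (card_nbhd v).le.trans (G.degree_le_maxDegree v))
    (fun t c hc hv => hc.exists_coloring fun v h => by
      simpa [ColState.contender, h] using hv v)
  rwa [one_mul] at this

end Colour

/-! ### The square graph, relaying, and 2-hop colouring -/

section TwoHop

variable {V : Type*} [Fintype V] [DecidableEq V] {G : SimpleGraph V} [DecidableRel G.Adj]

variable (G) in
/-- What the nodes perceive when the nodes with `b v = true` beep. -/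
def heard (b : V → Bool) (v : V) : ObsBL := perceiveBL (b v) (beepingNeighbours G b v)

theorem heard_eq_silence {b : V → Bool} {v : V} :
    heard G b v = ObsBL.silence ↔ b v = false ∧ ¬∃ u, G.Adj v u ∧ b u = true := by
  rw [← beepingNeighbours_eq_zero, heard, perceiveBL]
  cases b v <;> split_ifs <;> simp_all

theorem heard_eq_beepedAlone {b : V → Bool} {v : V} :
    heard G b v = ObsBL.beepedAlone ↔ b v = true ∧ ¬∃ u, G.Adj v u ∧ b u = true := by
  rw [← beepingNeighbours_eq_zero, heard, perceiveBL]
  cases b v <;> split_ifs <;> simp_all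

theorem heard_eq_heardSeveral {b : V → Bool} {v : V} :
    heard G b v = ObsBL.heardSeveral ↔
      b v = false ∧ ∃ u w, u ≠ w ∧ G.Adj v u ∧ G.Adj v w ∧ b u = true ∧ b w = true := by
  rw [← two_le_beepingNeighbours, heard, perceiveBL]
  cases b v <;> split_ifs <;> simp_all; omega

theorem heard_eq_heardOne_or {b : V → Bool} {v : V} :
    (heard G b v = ObsBL.heardOne ∨ heard G b v = ObsBL.heardSeveral) ↔
      b v = false ∧ ∃ u, G.Adj v u ∧ b u = true := by
  rw [← not_not (a := ∃ u, G.Adj v u ∧ b u = true), ← beepingNeighbours_eq_zero, heard, perceiveBL]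
  cases b v <;> split_ifs <;> simp_all

/-- Each neighbour of `v` leads to at most `Δ - 1` nodes other than `v`, and `Δ + Δ (Δ - 1) = Δ²`.
-/
theorem card_nbhd_square_le (v : V) : (nbhd (square G) v).card ≤ G.maxDegree ^ 2 := by
  have hsub : nbhd (square G) v ⊆ G.neighborFinset v ∪
      (G.neighborFinset v).biUnion fun w => (G.neighborFinset w).erase v := by
    intro u hu
    obtain ⟨hne, h⟩ := mem_nbhd.1 hu
    rcases h with h | ⟨w, h1, h2⟩
    · exact Finset.mem_union_left _ (by simpa using h)
    · refine Finset.mem_union_right _ (Finset.mem_biUnion.2 ⟨w, by simpa using h1, ?_⟩)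
      simpa using ⟨hne.symm, h2⟩
  have hdeg := G.degree_le_maxDegree v
  calc _ ≤ _ := Finset.card_le_card hsub
    _ ≤ (G.neighborFinset v).card +
        ((G.neighborFinset v).biUnion fun w => (G.neighborFinset w).erase v).card :=
        Finset.card_union_le _ _
    _ ≤ G.degree v + G.degree v * (G.maxDegree - 1) := by
        rw [SimpleGraph.card_neighborFinset_eq_degree]
        refine Nat.add_le_add_left ?_ _
        rw [← SimpleGraph.card_neighborFinset_eq_degree]
        refine Finset.card_biUnion_le_card_mul _ _ _ fun w hw => ?_
        have hw' : v ∈ G.neighborFinset w := by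
          simpa [SimpleGraph.adj_comm] using hw
        rw [Finset.card_erase_of_mem hw', SimpleGraph.card_neighborFinset_eq_degree]
        exact Nat.sub_le_sub_right (G.degree_le_maxDegree w) 1
    _ ≤ G.maxDegree ^ 2 := by
        rcases Nat.eq_zero_or_pos G.maxDegree with h | h
        · have : G.degree v = 0 := by omega
          simp [this]
        · obtain ⟨m, hm⟩ := Nat.exists_eq_succ_of_ne_zero h.ne'
          rw [hm] at hdeg ⊢
          simp only [Nat.succ_eq_add_one, Nat.add_sub_cancel] at hdeg ⊢
          nlinarith

section Relay

variable {halted b b' : V → Bool}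
  (hh : ∀ v, halted v = true → b v = false ∧ ∀ u, G.Adj v u → b u = false)
include hh

/-- If the nodes that hear several beeps relay this fact, then exactly the beeps that are exclusive
in the square graph are recognised as such. -/
theorem exclusive_iff
    (hb' : ∀ v, b' v = true ↔ halted v = false ∧ heard G b v = ObsBL.heardSeveral) {v : V} :
    (heard G b v = ObsBL.beepedAlone ∧ heard G b' v = ObsBL.silence) ↔
      b v = true ∧ ¬∃ u, (square G).Adj v u ∧ b u = true := by
  rw [heard_eq_beepedAlone, heard_eq_silence]
  constructor
  · rintro ⟨⟨hv, hn⟩, -, hn'⟩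
    refine ⟨hv, ?_⟩
    rintro ⟨u, ⟨hne, h⟩, hu⟩
    rcases h with h | ⟨w, h1, h2⟩
    · exact hn ⟨u, h, hu⟩
    -- The common neighbour `w` hears both `v` and `u` and reports it: `w` has not halted, since its
    -- neighbour `u` beeps, and `w` listens, since `v` beeps alone.
    · refine hn' ⟨w, h1, (hb' w).2 ⟨?_, heard_eq_heardSeveral.2 ⟨?_, v, u, hne, h1.symm, h2,
        hv, hu⟩⟩⟩
      · by_contra h
        simp [(hh w (by simpa using h)).2 u h2] at hu
      · by_contra h
        exact hn ⟨w, h1, by simpa using h⟩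
  · rintro ⟨hv, hn⟩
    have hn1 : ¬∃ u, G.Adj v u ∧ b u = true := fun ⟨u, h, hu⟩ =>
      hn ⟨u, ⟨h.ne, Or.inl h⟩, hu⟩
    refine ⟨⟨hv, hn1⟩, ?_, ?_⟩
    · by_contra h
      have := heard_eq_heardSeveral.1 ((hb' v).1 (by simpa using h)).2
      simp [hv] at this
    · rintro ⟨w, hw, hw'⟩
      obtain ⟨-, x, y, hxy, hx, hy, hbx, hby⟩ := heard_eq_heardSeveral.1 ((hb' w).1 hw').2
      -- Of the two beeping neighbours of `w`, at least one is not `v`, and it is within distance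
      -- two of `v`.
      by_cases hxv : x = v
      · subst hxv
        exact hn ⟨y, ⟨hxy, Or.inr ⟨w, hw, hy⟩⟩, hby⟩
      · exact hn ⟨x, ⟨Ne.symm hxv, Or.inr ⟨w, hw, hx⟩⟩, hbx⟩

/-- If the nodes that perceive a beep relay this fact, then silence means silence in the square
graph. -/
theorem silent_iff
    (hb' : ∀ v, b' v = true ↔ halted v = false ∧ heard G b v ≠ ObsBL.silence) {v : V}
    (hv : halted v = false) :
    (heard G b v = ObsBL.silence ∧ heard G b' v = ObsBL.silence) ↔
      b v = false ∧ ¬∃ u, (square G).Adj v u ∧ b u = true := by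
  rw [heard_eq_silence (b := b'), heard_eq_silence]
  constructor
  · rintro ⟨⟨hbv, hn⟩, -, hn'⟩
    refine ⟨hbv, ?_⟩
    rintro ⟨u, ⟨hne, h⟩, hu⟩
    rcases h with h | ⟨w, h1, h2⟩
    · exact hn ⟨u, h, hu⟩
    · refine hn' ⟨w, h1, (hb' w).2 ⟨?_, fun h => (heard_eq_silence.1 h).2 ⟨u, h2, hu⟩⟩⟩
      by_contra h
      simp [(hh w (by simpa using h)).2 u h2] at hu
  · rintro ⟨hbv, hn⟩
    have hn1 : ¬∃ u, G.Adj v u ∧ b u = true := fun ⟨u, h, hu⟩ =>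
      hn ⟨u, ⟨h.ne, Or.inl h⟩, hu⟩
    refine ⟨⟨hbv, hn1⟩, ?_, ?_⟩
    · by_contra h
      exact ((hb' v).1 (by simpa using h)).2 (heard_eq_silence.2 ⟨hbv, hn1⟩)
    · rintro ⟨w, hw, hw'⟩
      refine ((hb' w).1 hw').2 (heard_eq_silence.2 ⟨?_, ?_⟩)
      · by_contra h
        exact hn1 ⟨w, hw, by simpa using h⟩
      · rintro ⟨u, hu, hbu⟩
        by_cases huv : u = v
        · subst huv
          simp [hbv] at hbu
        · exact hn ⟨u, ⟨Ne.symm huv, Or.inr ⟨w, hw, hu⟩⟩, hbu⟩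

end Relay

/-- The 2-hop colouring algorithm as a contention. -/
def TwoHopState.contender (s : TwoHopState) : Contender := ⟨s.p, s.colour.isNone⟩

/-- The invariant of 2-hop colouring at the start of phase `t`. -/
structure TwoHopInvariant (G : SimpleGraph V) (t : ℕ) (c : V → TwoHopState) : Prop where
  partialColouring :
    PartialColouring (square G) t (fun v => (c v).colour) fun v => (c v).counter
  slot_eq : ∀ v, (c v).slot = TwoHopSlot.contending
  halted_iff : ∀ v, (c v).halted = true ↔
    (c v).colour ≠ none ∧ ∀ u, G.Adj v u → (c u).colour ≠ none

/-! The course of a phase of 2-hop colouring that starts from the configuration `c` and in whose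
contending slot the nodes with `b v = true` beep. -/

section Phase

variable (G) (c : V → TwoHopState) (b : V → Bool)

def twoHopDetect (v : V) : Bool :=
  !(c v).halted && decide (heard G b v = ObsBL.heardSeveral)

def twoHopColour (v : V) : Option ℕ :=
  if heard G b v = ObsBL.beepedAlone ∧ heard G (twoHopDetect G c b) v = ObsBL.silence then
    some (c v).counter else (c v).colour

def twoHopAdapt (v : V) : Bool := !(c v).halted && decide (heard G b v ≠ ObsBL.silence)

def twoHopProb (v : V) : unitInterval :=
  if (twoHopColour G c b v).isSome = true then (c v).p
  else if heard G b v = ObsBL.silence ∧ heard G (twoHopAdapt G c b) v = ObsBL.silence then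
    increase (c v).p else decrease (c v).p

def twoHopTerminate (v : V) : Bool := !(c v).halted && (twoHopColour G c b v).isNone

def twoHopPhase (v : V) : TwoHopState :=
  if (c v).halted = true then c v
  else
    { p := twoHopProb G c b v, colour := twoHopColour G c b v, counter := (c v).counter + 1
      obs := heard G b v, slot := TwoHopSlot.contending
      halted := decide (heard G (twoHopTerminate G c b) v = ObsBL.silence) }

end Phase

theorem slots_twoHop {t : ℕ} {c : V → TwoHopState} (hc : TwoHopInvariant G t c) :
    slots twoHopAlg perceiveBL G 4 c =
      (beepLaw fun v => contendProb (c v).contender).map (twoHopPhase G c) := by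
  have h1 : slots twoHopAlg perceiveBL G 1 c =
      (beepLaw fun v => contendProb (c v).contender).map fun b v =>
        if (c v).halted = true then c v
        else { c v with obs := heard G b v, slot := TwoHopSlot.detection } := by
    rw [slots_one]
    congr 1
    · funext b v
      simp only [twoHopAlg, hc.slot_eq v]
      rfl
    · congr 1
      funext v
      have h2 := hc.halted_iff v
      by_cases h : (c v).halted = true
      · simp [twoHopAlg, contendProb, TwoHopState.contender, h, (h2.1 h).1]
      · by_cases h' : (c v).colour = none <;>
          simp [twoHopAlg, hc.slot_eq v, contendProb, TwoHopState.contender, h, h',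
            Option.isSome_iff_ne_none]
  have h2 := slots_succ_of_deterministic (d := twoHopDetect G c)
    (g := fun b v => if (c v).halted = true then c v
      else { c v with
        obs := heard G b v, slot := TwoHopSlot.adaptation, colour := twoHopColour G c b v }) h1
    (fun b v => by
      by_cases h : (c v).halted = true <;> simp [twoHopAlg, twoHopDetect, h])
    (fun b v => by
      by_cases h : (c v).halted = true <;> simp [twoHopAlg, h]
      rfl)
  have h3 := slots_succ_of_deterministic (d := twoHopAdapt G c)
    (g := fun b v => if (c v).halted = true then c v
      else { c v with
        obs := heard G b v, slot := TwoHopSlot.termination, colour := twoHopColour G c b v,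
        p := twoHopProb G c b v }) h2
    (fun b v => by
      by_cases h : (c v).halted = true <;> simp [twoHopAlg, twoHopAdapt, h])
    (fun b v => by
      by_cases h : (c v).halted = true <;> simp [twoHopAlg, h]
      rfl)
  refine slots_succ_of_deterministic (d := twoHopTerminate G c) h3
    (fun b v => ?_) (fun b v => ?_)
  · by_cases h : (c v).halted = true <;> by_cases h' : twoHopColour G c b v = none <;>
      simp [twoHopAlg, twoHopTerminate, h, h', Option.isSome_iff_ne_none]
  · by_cases h : (c v).halted = true <;> simp [twoHopAlg, h, twoHopPhase]
    rfl

/-- A halted node is coloured and has only coloured neighbours, so it has no contending beep to make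
or to relay; early termination therefore does not disturb the other nodes. -/
theorem twoHop_phaseContends (t : ℕ) (c : V → TwoHopState) (hc : TwoHopInvariant G t c) :
    PhaseContends twoHopAlg perceiveBL G 4 (square G) TwoHopState.contender
      (TwoHopInvariant G (t + 1)) c := by
  refine ⟨_, slots_twoHop hc, fun b hb => ?_⟩
  have hb' : ∀ v, b v = true → (c v).colour = none := fun v hv => by
    simpa [TwoHopState.contender] using hb v hv
  have hh : ∀ v, (c v).halted = true → b v = false ∧ ∀ u, G.Adj v u → b u = false := by
    intro v hv
    obtain ⟨h1, h2⟩ := (hc.halted_iff v).1 hv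
    refine ⟨?_, fun u hu => ?_⟩
    · by_contra h; exact h1 (hb' v (by simpa using h))
    · by_contra h; exact h2 u hu (hb' u (by simpa using h))
  have hexcl : ∀ v, (heard G b v = ObsBL.beepedAlone ∧
      heard G (twoHopDetect G c b) v = ObsBL.silence) ↔
      b v = true ∧ ¬∃ u, (square G).Adj v u ∧ b u = true := fun v =>
    exclusive_iff hh (fun v => by simp [twoHopDetect])
  have hsilent : ∀ v, (c v).halted = false → ((heard G b v = ObsBL.silence ∧
      heard G (twoHopAdapt G c b) v = ObsBL.silence) ↔
      b v = false ∧ ¬∃ u, (square G).Adj v u ∧ b u = true) := fun v hv =>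
    silent_iff hh (fun v => by simp [twoHopAdapt]) hv
  -- For halted nodes the two sides agree because such a node does not beep and hence keeps its
  -- colour.
  have hcol : ∀ v, (twoHopPhase G c b v).colour = twoHopColour G c b v := by
    intro v
    by_cases h : (c v).halted = true
    · rw [twoHopPhase, if_pos h, twoHopColour, if_neg]
      rw [hexcl]
      simp [(hh v h).1]
    · rw [twoHopPhase, if_neg h]
  have hcol_mono : ∀ v, (c v).colour ≠ none → twoHopColour G c b v ≠ none := by
    intro v hv
    unfold twoHopColour
    split_ifs <;> simp [hv]
  have halone : ∀ v, b v = true → (¬∃ u, (square G).Adj v u ∧ b u = true) →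
      twoHopColour G c b v = some (c v).counter := fun v h1 h2 => by
    rw [twoHopColour, if_pos ((hexcl v).2 ⟨h1, h2⟩)]
  have hother : ∀ v, ¬(b v = true ∧ ¬∃ u, (square G).Adj v u ∧ b u = true) →
      twoHopColour G c b v = (c v).colour := fun v h => by
    rw [twoHopColour, if_neg (by rwa [hexcl])]
  refine ⟨⟨?_, fun v => ?_, fun v => ?_⟩, fun v => ?_⟩
  · simp only [hcol]
    refine hc.partialColouring.step hb' halone hother fun v hv => ?_
    have : ¬(c v).halted = true := fun h => hcol_mono v ((hc.halted_iff v).1 h).1 hv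
    rw [twoHopPhase, if_neg this]
  · unfold twoHopPhase
    split_ifs
    · exact hc.slot_eq v
    · rfl
  · simp only [hcol]
    by_cases h : (c v).halted = true
    · have h' := (hc.halted_iff v).1 h
      rw [twoHopPhase, if_pos h]
      exact ⟨fun _ => ⟨hcol_mono v h'.1, fun u hu => hcol_mono u (h'.2 u hu)⟩, fun _ => h⟩
    -- Halted nodes are coloured, so their passivity in the termination slot is not misleading:
    -- silence there means that the closed neighbourhood is coloured.
    · have hterm : ∀ u, twoHopTerminate G c b u = true ↔ twoHopColour G c b u = none := by
        intro u
        simp only [twoHopTerminate, Bool.and_eq_true, Bool.not_eq_true', Option.isNone_iff_eq_none,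
          and_iff_right_iff_imp]
        intro hu
        by_contra h
        exact hcol_mono u ((hc.halted_iff u).1 (by simpa using h)).1 hu
      rw [twoHopPhase, if_neg h]
      simp only [decide_eq_true_eq]
      rw [heard_eq_silence, ← Bool.not_eq_true]
      simp only [hterm, not_exists, not_and, ne_eq]
  · by_cases hv : (c v).colour = none
    · have hnh : ¬(c v).halted = true := fun h => ((hc.halted_iff v).1 h).1 hv
      have hact : (c v).contender.active = true := by simp [TwoHopState.contender, hv]
      have hs := hsilent v (by simpa using hnh)
      rw [twoHopPhase, if_neg hnh]
      by_cases hn : ∃ u, (square G).Adj v u ∧ b u = true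
      · have hcv := (hother v (fun h => h.2 hn)).trans hv
        rw [contend_of_noisy (x := fun u => (c u).contender) hact hn]
        simp only [TwoHopState.contender, twoHopProb, hcv]
        rw [if_neg (by simp), if_neg (fun h => (hs.1 h).2 hn)]
        rfl
      · cases hbv : b v
        · have hcv := (hother v (fun h => by simp [hbv] at h)).trans hv
          rw [contend_of_silent (x := fun u => (c u).contender) hact hn hbv]
          simp only [TwoHopState.contender, twoHopProb, hcv]
          rw [if_neg (by simp), if_pos (hs.2 ⟨hbv, hn⟩)]
          rfl
        · have hcv := halone v hbv hn
          rw [contend_of_alone (x := fun u => (c u).contender) hact hn hbv]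
          simp [TwoHopState.contender, twoHopProb, hcv]
    · rw [contend_of_inactive (by simpa [TwoHopState.contender, Option.isSome_iff_ne_none] using hv)]
      have hcv : twoHopColour G c b v = (c v).colour :=
        hother v (fun h => hv (hb' v h.1))
      unfold twoHopPhase
      split_ifs
      · rfl
      · simp [TwoHopState.contender, twoHopProb, hcv, Option.isSome_iff_ne_none, hv]

theorem le_probAfter_twoHopColoured :
    1 - 600 * (Fintype.card V : ℝ) ^ (-(5 / 4) : ℝ) ≤
      probAfter twoHopAlg perceiveBL G (4 * phases (Fintype.card V) (G.maxDegree ^ 2))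
        (TwoHopColoured G) := by
  refine le_probAfter (proj := TwoHopState.contender) (Inv := TwoHopInvariant G) ?_ rfl
    twoHop_phaseContends card_nbhd_square_le (fun t c hc hv => ?_)
  · exact ⟨PartialColouring.init _, fun _ => rfl, fun v => by simp [twoHopAlg]⟩
  · have hcol : ∀ v, (c v).colour ≠ none := fun v h => by
      simpa [TwoHopState.contender, h] using hv v
    exact ⟨fun v => (hc.halted_iff v).2 ⟨hcol v, fun u _ => hcol u⟩,
      hc.partialColouring.exists_coloring hcol⟩

end TwoHop

/-! ### Degree computation -/

section Degree

variable {V : Type*} [Fintype V] [DecidableEq V] {G : SimpleGraph V} [DecidableRel G.Adj]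

/-- The degree computation algorithm as a contention. -/
def DegreeState.contender (s : DegreeState) : Contender := ⟨s.p, !s.counted⟩

/-- The invariant of degree computation at the start of a phase. -/
structure DegreeInvariant (G : SimpleGraph V) [DecidableRel G.Adj] (c : V → DegreeState) :
    Prop where
  degree_eq : ∀ v,
    (c v).degree = (Finset.univ.filter fun u => G.Adj v u ∧ (c u).counted = true).card
  slot_eq : ∀ v, (c v).slot = DegreeSlot.contending
  halted_iff : ∀ v, (c v).halted = true ↔
    (c v).counted = true ∧ ∀ u, G.Adj v u → (c u).counted = true

/-! The course of a phase of degree computation that starts from the configuration `c` and in whose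
contending slot the nodes with `b v = true` beep. -/

section Phase

variable (G) (c : V → DegreeState) (b : V → Bool)

def degreeDetect (v : V) : Bool :=
  !(c v).halted && decide (heard G b v = ObsBL.heardSeveral)

def degreeExcl (v : V) : Bool :=
  decide (heard G b v = ObsBL.beepedAlone ∧ heard G (degreeDetect G c b) v = ObsBL.silence)

def degreeConfirm (v : V) : Bool := !(c v).halted && degreeExcl G c b v

def degreeCount (v : V) : ℕ :=
  if heard G (degreeConfirm G c b) v = ObsBL.heardOne ∨
      heard G (degreeConfirm G c b) v = ObsBL.heardSeveral then (c v).degree + 1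
  else (c v).degree

def degreeAdapt (v : V) : Bool := !(c v).halted && decide (heard G b v ≠ ObsBL.silence)

def degreeProb (v : V) : unitInterval :=
  if ((c v).counted || degreeExcl G c b v) = true then (c v).p
  else if heard G b v = ObsBL.silence ∧ heard G (degreeAdapt G c b) v = ObsBL.silence then
    increase (c v).p else decrease (c v).p

def degreeTerminate (v : V) : Bool :=
  !(c v).halted && !((c v).counted || degreeExcl G c b v)

def degreePhase (v : V) : DegreeState :=
  if (c v).halted = true then c v
  else
    { p := degreeProb G c b v, counted := (c v).counted || degreeExcl G c b v
      excl := degreeExcl G c b v, degree := degreeCount G c b v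
      obs := heard G b v, slot := DegreeSlot.contending
      halted := decide (heard G (degreeTerminate G c b) v = ObsBL.silence) }

end Phase

theorem slots_degree {c : V → DegreeState} (hc : DegreeInvariant G c) :
    slots degreeAlg perceiveBL G 5 c =
      (beepLaw fun v => contendProb (c v).contender).map (degreePhase G c) := by
  have h1 : slots degreeAlg perceiveBL G 1 c =
      (beepLaw fun v => contendProb (c v).contender).map fun b v =>
        if (c v).halted = true then c v
        else { c v with obs := heard G b v, slot := DegreeSlot.detection } := by
    rw [slots_one]
    congr 1
    · funext b v
      simp only [degreeAlg, hc.slot_eq v]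
      rfl
    · congr 1
      funext v
      have h2 := hc.halted_iff v
      by_cases h : (c v).halted = true
      · simp [degreeAlg, contendProb, DegreeState.contender, h, (h2.1 h).1]
      · by_cases h' : (c v).counted = true <;>
          simp [degreeAlg, hc.slot_eq v, contendProb, DegreeState.contender, h, h']
  have h2 := slots_succ_of_deterministic (d := degreeDetect G c)
    (g := fun b v => if (c v).halted = true then c v
      else { c v with
        obs := heard G b v, slot := DegreeSlot.confirmation, excl := degreeExcl G c b v,
        counted := (c v).counted || degreeExcl G c b v }) h1
    (fun b v => by
      by_cases h : (c v).halted = true <;> simp [degreeAlg, degreeDetect, h])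
    (fun b v => by
      by_cases h : (c v).halted = true
      · simp [degreeAlg, h]
      · simp only [degreeAlg, h]; rfl)
  have h3 := slots_succ_of_deterministic (d := degreeConfirm G c)
    (g := fun b v => if (c v).halted = true then c v
      else { c v with
        obs := heard G b v, slot := DegreeSlot.adaptation, excl := degreeExcl G c b v,
        counted := (c v).counted || degreeExcl G c b v, degree := degreeCount G c b v }) h2
    (fun b v => by
      by_cases h : (c v).halted = true <;> simp [degreeAlg, degreeConfirm, h])
    (fun b v => by
      by_cases h : (c v).halted = true
      · simp [degreeAlg, h]
      · simp only [degreeAlg, h]; rfl)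
  have h4 := slots_succ_of_deterministic (d := degreeAdapt G c)
    (g := fun b v => if (c v).halted = true then c v
      else { c v with
        obs := heard G b v, slot := DegreeSlot.termination, excl := degreeExcl G c b v,
        counted := (c v).counted || degreeExcl G c b v, degree := degreeCount G c b v,
        p := degreeProb G c b v }) h3
    (fun b v => by
      by_cases h : (c v).halted = true <;> simp [degreeAlg, degreeAdapt, h])
    (fun b v => by
      by_cases h : (c v).halted = true
      · simp [degreeAlg, h]
      · simp only [degreeAlg, h]; rfl)
  refine slots_succ_of_deterministic (d := degreeTerminate G c) h4
    (fun b v => ?_) (fun b v => ?_)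
  · by_cases h : (c v).halted = true <;> cases h' : (c v).counted <;>
      cases h'' : degreeExcl G c b v <;> simp [degreeAlg, degreeTerminate, h, h', h'']
  · by_cases h : (c v).halted = true
    · simp [degreeAlg, degreePhase, h]
    · simp only [degreeAlg, degreePhase, h]; rfl

/-- The degree counter records the number of counted neighbours. Two neighbours of a node are
adjacent in `square G`, so at most one of them becomes counted per phase and no confirmation beeps
collide. -/
theorem degree_phaseContends (c : V → DegreeState) (hc : DegreeInvariant G c) :
    PhaseContends degreeAlg perceiveBL G 5 (square G) DegreeState.contender
      (DegreeInvariant G) c := by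
  refine ⟨_, slots_degree hc, fun b hb => ?_⟩
  have hb' : ∀ v, b v = true → (c v).counted = false := fun v hv => by
    simpa [DegreeState.contender] using hb v hv
  have hh : ∀ v, (c v).halted = true → b v = false ∧ ∀ u, G.Adj v u → b u = false := by
    intro v hv
    obtain ⟨h1, h2⟩ := (hc.halted_iff v).1 hv
    refine ⟨?_, fun u hu => ?_⟩
    · by_contra h; simp [hb' v (by simpa using h)] at h1
    · by_contra h
      have := h2 u hu
      simp [hb' u (by simpa using h)] at this
  have hexcl : ∀ v, degreeExcl G c b v = true ↔
      b v = true ∧ ¬∃ u, (square G).Adj v u ∧ b u = true := fun v => by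
    rw [degreeExcl, decide_eq_true_eq]
    exact exclusive_iff hh (fun v => by simp [degreeDetect])
  have hsilent : ∀ v, (c v).halted = false → ((heard G b v = ObsBL.silence ∧
      heard G (degreeAdapt G c b) v = ObsBL.silence) ↔
      b v = false ∧ ¬∃ u, (square G).Adj v u ∧ b u = true) := fun v hv =>
    silent_iff hh (fun v => by simp [degreeAdapt]) hv
  have hcnt : ∀ v, (degreePhase G c b v).counted = true ↔
      (c v).counted = true ∨ degreeExcl G c b v = true := by
    intro v
    by_cases h : (c v).halted = true
    · rw [degreePhase, if_pos h, hexcl]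
      simp [(hh v h).1]
    · rw [degreePhase, if_neg h]
      simp
  have hconf : ∀ v, degreeConfirm G c b v = true ↔ degreeExcl G c b v = true := by
    intro v
    simp only [degreeConfirm, Bool.and_eq_true, Bool.not_eq_true', and_iff_right_iff_imp]
    intro h
    by_contra h'
    have := (hh v (by simpa using h')).1
    simp [((hexcl v).1 h).1] at this
  have hunique : ∀ u w, (square G).Adj u w → degreeExcl G c b u = true →
      degreeExcl G c b w = true → False := fun u w huw hu hw =>
    ((hexcl u).1 hu).2 ⟨w, huw, ((hexcl w).1 hw).1⟩
  refine ⟨⟨fun v => ?_, fun v => ?_, fun v => ?_⟩, fun v => ?_⟩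
  · simp only [hcnt]
    by_cases h : (c v).halted = true
    · have h' := (hc.halted_iff v).1 h
      rw [degreePhase, if_pos h, hc.degree_eq]
      congr 1
      ext u
      simp only [Finset.mem_filter, Finset.mem_univ, true_and]
      exact ⟨fun hu => ⟨hu.1, Or.inl hu.2⟩, fun hu => ⟨hu.1, h'.2 u hu.1⟩⟩
    · rw [degreePhase, if_neg h]
      simp only [degreeCount, heard_eq_heardOne_or, hconf]
      by_cases hu : ∃ u, G.Adj v u ∧ degreeExcl G c b u = true
      · obtain ⟨u, huv, hu⟩ := hu
        -- A confirmation beep is heard only by a listener; `v` does listen, because it cannot be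
        -- exclusive together with its neighbour `u`.
        have hv : degreeConfirm G c b v = false := by
          by_contra hv
          exact hunique v u ⟨huv.ne, Or.inl huv⟩ ((hconf v).1 (by simpa using hv)) hu
        -- The set of counted neighbours gains exactly `u`, which was not counted before because it
        -- contended in this phase.
        rw [if_pos ⟨hv, u, huv, hu⟩, hc.degree_eq, ← Finset.card_insert_of_notMem (a := u)]
        · congr 1
          ext w
          simp only [Finset.mem_insert, Finset.mem_filter, Finset.mem_univ, true_and]
          constructor
          · rintro (rfl | hw)
            · exact ⟨huv, Or.inr hu⟩
            · exact ⟨hw.1, Or.inl hw.2⟩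
          · rintro ⟨hw, hw' | hw'⟩
            · exact Or.inr ⟨hw, hw'⟩
            · left
              by_contra hne
              exact hunique w u ⟨hne, Or.inr ⟨v, hw.symm, huv⟩⟩ hw' hu
        · simp [hb' u ((hexcl u).1 hu).1]
      · rw [if_neg (fun h => hu h.2), hc.degree_eq]
        congr 1
        ext u
        simp only [Finset.mem_filter, Finset.mem_univ, true_and]
        exact ⟨fun h => ⟨h.1, Or.inl h.2⟩,
          fun h => ⟨h.1, h.2.resolve_right fun h' => hu ⟨u, h.1, h'⟩⟩⟩
  · unfold degreePhase
    split_ifs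
    · exact hc.slot_eq v
    · rfl
  · simp only [hcnt]
    by_cases h : (c v).halted = true
    · have h' := (hc.halted_iff v).1 h
      rw [degreePhase, if_pos h]
      exact ⟨fun _ => ⟨Or.inl h'.1, fun u hu => Or.inl (h'.2 u hu)⟩, fun _ => h⟩
    · have hterm : ∀ u, degreeTerminate G c b u = true ↔
          ¬((c u).counted = true ∨ degreeExcl G c b u = true) := by
        intro u
        rw [← Bool.or_eq_true]
        simp only [degreeTerminate, Bool.and_eq_true, Bool.not_eq_true', Bool.not_eq_true,
          and_iff_right_iff_imp]
        intro hu
        by_contra h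
        rw [((hc.halted_iff u).1 (by simpa using h)).1] at hu
        simp at hu
      rw [degreePhase, if_neg h]
      simp only [decide_eq_true_eq]
      rw [heard_eq_silence, ← Bool.not_eq_true]
      simp only [hterm, not_exists, not_and, not_not]
  · by_cases hv : (c v).counted = true
    · rw [contend_of_inactive (by simp [DegreeState.contender, hv])]
      unfold degreePhase
      split_ifs
      · rfl
      · simp [DegreeState.contender, degreeProb, hv]
    · rw [Bool.not_eq_true] at hv
      have hnh : ¬(c v).halted = true := fun h => by
        simp [((hc.halted_iff v).1 h).1] at hv
      have hact : (c v).contender.active = true := by simp [DegreeState.contender, hv]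
      have hs := hsilent v (by simpa using hnh)
      rw [degreePhase, if_neg hnh]
      by_cases hn : ∃ u, (square G).Adj v u ∧ b u = true
      · have he : degreeExcl G c b v = false := by
          by_contra h; exact ((hexcl v).1 (by simpa using h)).2 hn
        rw [contend_of_noisy (x := fun u => (c u).contender) hact hn]
        simp only [DegreeState.contender, degreeProb, he, hv]
        rw [if_neg (by simp), if_neg (fun h => (hs.1 h).2 hn)]
        rfl
      · cases hbv : b v
        · have he : degreeExcl G c b v = false := by
            by_contra h
            have := ((hexcl v).1 (by simpa using h)).1
            simp [hbv] at this
          rw [contend_of_silent (x := fun u => (c u).contender) hact hn hbv]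
          simp only [DegreeState.contender, degreeProb, he, hv]
          rw [if_neg (by simp), if_pos (hs.2 ⟨hbv, hn⟩)]
          rfl
        · have he := (hexcl v).2 ⟨hbv, hn⟩
          rw [contend_of_alone (x := fun u => (c u).contender) hact hn hbv]
          simp [DegreeState.contender, degreeProb, he]

theorem le_probAfter_degreesComputed :
    1 - 600 * (Fintype.card V : ℝ) ^ (-(5 / 4) : ℝ) ≤
      probAfter degreeAlg perceiveBL G (5 * phases (Fintype.card V) (G.maxDegree ^ 2))
        (DegreesComputed G) := by
  refine le_probAfter (proj := DegreeState.contender) (Inv := fun _ => DegreeInvariant G) ?_ rfl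
    (fun _ => degree_phaseContends) card_nbhd_square_le (fun _ c hc hv => ?_)
  · exact ⟨fun v => by simp [degreeAlg], fun _ => rfl, fun v => by simp [degreeAlg]⟩
  · have hcnt : ∀ v, (c v).counted = true := fun v => by
      simpa [DegreeState.contender] using hv v
    refine fun v => ⟨(hc.halted_iff v).2 ⟨hcnt v, fun u _ => hcnt u⟩, ?_⟩
    rw [hc.degree_eq, ← SimpleGraph.card_neighborFinset_eq_degree]
    congr 1
    ext u
    simp [hcnt]

end Degree

/-- The ratio of the two sides is `600 n^(-1/4)`. -/
theorem isLittleO_failure :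
    (fun n : ℕ => 600 * (n : ℝ) ^ (-(5 / 4) : ℝ)) =o[Filter.atTop] fun n : ℕ => ((n : ℝ))⁻¹ := by
  refine (Asymptotics.isLittleO_iff_tendsto' ?_).2 ?_
  · filter_upwards [Filter.eventually_gt_atTop 0] with n hn h
    simp [hn.ne'] at h
  · have h := ((tendsto_rpow_neg_atTop (y := 1 / 4) (by norm_num)).comp
      tendsto_natCast_atTop_atTop).const_mul (600 : ℝ)
    rw [mul_zero] at h
    refine h.congr' ?_
    filter_upwards [Filter.eventually_gt_atTop 0] with n hn
    have hn' : (0 : ℝ) < n := by exact_mod_cast hn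
    rw [div_inv_eq_mul, mul_assoc, ← Real.rpow_add_one hn'.ne']
    norm_num

end

end Beeping

theorem mainTheorem3 :
    ∃ δ : ℕ → ℝ, Asymptotics.IsLittleO Filter.atTop δ (fun n : ℕ => ((n : ℝ))⁻¹) ∧
      ∀ (V : Type*) [Fintype V] [DecidableEq V] (G : SimpleGraph V) [DecidableRel G.Adj],
        1 - δ (Fintype.card V) ≤
          Beeping.probAfter Beeping.colouringAlg Beeping.perceiveB G
            (Beeping.phases (Fintype.card V) G.maxDegree)
            (Beeping.Coloured G) ∧
        1 - δ (Fintype.card V) ≤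
          Beeping.probAfter Beeping.twoHopAlg Beeping.perceiveBL G
            (4 * Beeping.phases (Fintype.card V) (G.maxDegree ^ 2))
            (Beeping.TwoHopColoured G) ∧
        1 - δ (Fintype.card V) ≤
          Beeping.probAfter Beeping.degreeAlg Beeping.perceiveBL G
            (5 * Beeping.phases (Fintype.card V) (G.maxDegree ^ 2))
            (Beeping.DegreesComputed G) := by
  exact ⟨fun n => 600 * (n : ℝ) ^ (-(5 / 4) : ℝ), Beeping.isLittleO_failure,
    fun V _ _ G _ => ⟨Beeping.le_probAfter_coloured, Beeping.le_probAfter_twoHopColoured,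
      Beeping.le_probAfter_degreesComputed⟩⟩
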